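/- Let $V=\{1,\dots,n\}$ and let $G=(V,E^+)$ be a complete graph with edges labelled $+$ or $-$, identified with its graph $E^+$ of $+$ edges. A clustering is a function $\ell:V\to\mathbb N$; its cost is the number of unordered pairs $\{x,y\}$ that are $-$ edges with $\ell(x)=\ell(y)$ or $+$ edges with $\ell(x)\ne\ell(y)$; $\mathrm{OPT}$ is the minimum cost of a clustering of $G$. Write $\Gamma^+(v)$ for the set of vertices joined to $v$ by a $+$ edge. Algorithm Non-adaptive QECC, with query budget a positive integer $Q$: put $k=\max\{t\le n : (2n-1-t)\,t\le 2Q\}$ and draw a uniformly random sequence $s_1,\dots,s_k$ of vertices, with or without replacement. Query, once each, all pairs $\{v,w\}$ with $v\in\{s_1,\dots,s_k\}$ and $w\in V\setminus\{v\}$. Then, starting from $R=V$, for $i=1,\dots,k$: if $s_i\in R$, output the cluster $C=\{s_i\}\cup(\Gamma^+(s_i)\cap R)$ and remove $C$ from $R$. The vertices remaining in $R$ are singleton clusters. Theorem. For every integer $Q>0$, Non-adaptive QECC makes at most $Q$ queries, all of them fixed before any answer is seen (their distribution does not depend on $G$), and it finds a clustering of $G$ with expected cost at most $$3\cdot\mathrm{OPT}+\frac{n^3}{2Q};$$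 when the sample is drawn with replacement, the bound on the expected cost is claimed for $Q\le n^2$ (which includes every $Q\le\binom n2$). It runs in time $O(Q)$, with a constant that does not depend on $n$, $Q$ or $G$, assuming that a query, the drawing of a uniformly random element of $\{0,\dots,m-1\}$, an arithmetic operation and an access to a dictionary take unit time, and that the vertices left in $R$ at the end are represented implicitly (as the vertices without a cluster label). -/

import Mathlib

open scoped ENNReal

/-! ### Correlation clustering

A complete graph on `Fin n` with `+`/`-` edge labels is identified with the graph of its `+` edges. -/

open Classical in
/-- The 0/1 similarity function of a labelled complete graph. -/
noncomputable def similarity {n : ℕ} (G : SimpleGraph (Fin n)) (x y : Fin n) : ℕ :=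
  if G.Adj x y then 1 else 0

/-- The number of disagreements of the clustering `cl` (a labelling of the vertices by cluster
identifiers), summed over the unordered pairs of distinct vertices. -/
noncomputable def clusteringCost {n : ℕ} (G : SimpleGraph (Fin n)) (cl : Fin n → ℕ) : ℕ :=
  (∑ p : Fin n × Fin n with p.1 < p.2 ∧ cl p.1 = cl p.2, (1 - similarity G p.1 p.2)) +
    ∑ p : Fin n × Fin n with p.1 < p.2 ∧ cl p.1 ≠ cl p.2, similarity G p.1 p.2

/-- The cost of an optimal clustering. -/
noncomputable def optCost {n : ℕ} (G : SimpleGraph (Fin n)) : ℕ :=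
  sInf (Set.range (clusteringCost G))

/-! ### A randomized unit-cost machine with batched queries

Programs over natural-number registers (named by `ι`) and dictionaries keyed by pairs of numbers
(named by `τ`, initially everywhere `0`). Each elementary operation takes one step. A program can
request a similarity query, but it does not see the graph: the answers become available in the
read-only dictionary `answers` only when all requests made so far are answered in one batch. -/

/-- Expressions. Comparisons and connectives have value `0` or `1`; subtraction is truncated. -/
inductive Expr (ι τ : Type) : Type
  | const (c : ℕ)
  | var (x : ι)
  | get (t : τ) (a b : Expr ι τ)
  | answer (a b : Expr ι τ)
  | add (a b : Expr ι τ)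
  | sub (a b : Expr ι τ)
  | mul (a b : Expr ι τ)
  | le (a b : Expr ι τ)
  | eq (a b : Expr ι τ)
  | and (a b : Expr ι τ)
  | or (a b : Expr ι τ)

/-- Commands. -/
inductive Cmd (ι τ : Type) : Type
  /-- `x := a` -/
  | set (x : ι) (a : Expr ι τ)
  /-- `t[a, b] := c` -/
  | put (t : τ) (a b c : Expr ι τ)
  /-- `x :=` a uniformly random element of `{0, …, a - 1}` (and `x := 0` if `a = 0`) -/
  | rand (x : ι) (a : Expr ι τ)
  /-- request the query of the pair `(a, b)` -/
  | ask (a b : Expr ι τ)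
  | seq (c d : Cmd ι τ)
  /-- `if a ≠ 0 then c` -/
  | when (a : Expr ι τ) (c : Cmd ι τ)
  /-- `for x = 0, …, a - 1 do c`, where `a` is evaluated once, on entry -/
  | loop (x : ι) (a : Expr ι τ) (c : Cmd ι τ)

/-- Configurations: registers, dictionaries, answers received, the list of all requests made, and
the number of steps taken so far. -/
structure Config (ι τ : Type) : Type where
  reg : ι → ℕ
  tab : τ → ℕ → ℕ → ℕ
  answers : ℕ → ℕ → ℕ
  requests : List (ℕ × ℕ)
  time : ℕ

namespace Expr

variable {ι τ : Type}

/-- The value of an expression. -/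
def eval (s : Config ι τ) : Expr ι τ → ℕ
  | const c => c
  | var x => s.reg x
  | get t a b => s.tab t (a.eval s) (b.eval s)
  | answer a b => s.answers (a.eval s) (b.eval s)
  | add a b => a.eval s + b.eval s
  | sub a b => a.eval s - b.eval s
  | mul a b => a.eval s * b.eval s
  | le a b => if a.eval s ≤ b.eval s then 1 else 0
  | eq a b => if a.eval s = b.eval s then 1 else 0
  | and a b => if a.eval s ≠ 0 ∧ b.eval s ≠ 0 then 1 else 0
  | or a b => if a.eval s ≠ 0 ∨ b.eval s ≠ 0 then 1 else 0

/-- The number of steps to evaluate an expression: one for each node. -/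
def steps : Expr ι τ → ℕ
  | const _ => 1
  | var _ => 1
  | get _ a b => a.steps + b.steps + 1
  | answer a b => a.steps + b.steps + 1
  | add a b => a.steps + b.steps + 1
  | sub a b => a.steps + b.steps + 1
  | mul a b => a.steps + b.steps + 1
  | le a b => a.steps + b.steps + 1
  | eq a b => a.steps + b.steps + 1
  | and a b => a.steps + b.steps + 1
  | or a b => a.steps + b.steps + 1

end Expr

namespace Config

variable {ι τ : Type}

/-- Let `m` steps pass. -/
def tick (s : Config ι τ) (m : ℕ) : Config ι τ := { s with time := s.time + m }

/-- Store `m` in the register `x`. -/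
def setReg [DecidableEq ι] (s : Config ι τ) (x : ι) (m : ℕ) : Config ι τ :=
  { s with reg := Function.update s.reg x m }

/-- Store `m` in the dictionary `t` under the key `(a, b)`. -/
def setTab [DecidableEq τ] (s : Config ι τ) (t : τ) (a b m : ℕ) : Config ι τ :=
  { s with
    tab := Function.update s.tab t (Function.update (s.tab t) a (Function.update (s.tab t a) b m)) }

/-- Add the pair `(a, b)` to the list of requests. -/
def addRequest (s : Config ι τ) (a b : ℕ) : Config ι τ :=
  { s with requests := (a, b) :: s.requests }

open Classical in
/-- Answer all requests made so far, in one batch, at one step per query. -/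
noncomputable def answerRequests {n : ℕ} (G : SimpleGraph (Fin n)) (s : Config ι τ) :
    Config ι τ :=
  { s with
    answers := fun a b =>
      if (a, b) ∈ s.requests ∧ ∃ (ha : a < n) (hb : b < n), G.Adj ⟨a, ha⟩ ⟨b, hb⟩ then 1 else 0
    time := s.time + s.requests.length }

end Config

/-- The uniform distribution on `{0, …, m - 1}` (the point mass at `0` if `m = 0`). -/
noncomputable def uniformBelow (m : ℕ) : PMF ℕ :=
  if h : 0 < m then PMF.uniformOfFinset (Finset.range m) ⟨0, Finset.mem_range.2 h⟩
  else PMF.pure 0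

/-- `iterateFor f m s`: run `f 0`, `f 1`, …, `f (m - 1)` in this order, starting from `s`. -/
noncomputable def iterateFor {σ : Type} (f : ℕ → σ → PMF σ) : ℕ → σ → PMF σ
  | 0, s => PMF.pure s
  | m + 1, s => (iterateFor f m s).bind (f m)

/-- The distribution of the configuration reached by a command. -/
noncomputable def Cmd.run {ι τ : Type} [DecidableEq ι] [DecidableEq τ] :
    Cmd ι τ → Config ι τ → PMF (Config ι τ)
  | .set x a => fun s => PMF.pure ((s.setReg x (a.eval s)).tick (a.steps + 1))
  | .put t a b c => fun s =>
      PMF.pure ((s.setTab t (a.eval s) (b.eval s) (c.eval s)).tick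
        (a.steps + b.steps + c.steps + 1))
  | .rand x a => fun s =>
      (uniformBelow (a.eval s)).map fun m => (s.setReg x m).tick (a.steps + 1)
  | .ask a b => fun s =>
      PMF.pure ((s.addRequest (a.eval s) (b.eval s)).tick (a.steps + b.steps + 1))
  | .seq c d => fun s => (c.run s).bind d.run
  | .when a c => fun s =>
      if a.eval s ≠ 0 then c.run (s.tick (a.steps + 1)) else PMF.pure (s.tick (a.steps + 1))
  | .loop x a c => fun s =>
      iterateFor (fun i s' => c.run ((s'.setReg x i).tick 1)) (a.eval s) (s.tick (a.steps + 1))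

/-- The expectation of a nonnegative function of a random outcome. -/
noncomputable def expectedValue {σ : Type} (p : PMF σ) (f : σ → ℝ≥0∞) : ℝ≥0∞ :=
  ∑' s, p s * f s

/-! ### The algorithm Non-adaptive QECC -/

namespace NAQECC

/-- The two ways of drawing the sample of pivots. -/
inductive Sampling : Type
  | withReplacement
  | withoutReplacement

/-- Registers. The inputs are `n` (number of vertices) and `Q` (query budget). -/
inductive Reg : Type
  | n | Q | k | t | i | v | w | r | u
  deriving DecidableEq

/-- Dictionaries; a key that is a single number `a` is written as `(a, 0)`. -/
inductive Tab : Type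
  /-- `sample[i]` is the `i`-th vertex of the sample -/
  | sample
  /-- `swap[j]` is `0` if position `j` of the shuffled list `0, …, n - 1` still holds `j`, and
  otherwise it is the element held there plus one -/
  | swap
  /-- `mark[v] = 1` if the requests of the pairs with `v` have been made -/
  | mark
  /-- `label[v]` is the identifier of the cluster of `v`, and `0` as long as `v` is unclustered -/
  | label
  deriving DecidableEq

open Expr Cmd

/-- `k := max {t ≤ n ∣ (2 n - 1 - t) t ≤ 2 Q}`; it suffices to try `t ≤ Q + 1`, as the maximum never
exceeds `Q + 1`. -/
def computeK : Cmd Reg Tab :=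
  .loop .t (add (var .Q) (const 2)) <|
    .when (le (var .t) (var .n)) <|
      .when (le (mul (sub (sub (mul (const 2) (var .n)) (const 1)) (var .t)) (var .t))
        (mul (const 2) (var .Q))) <|
        .set .k (var .t)

/-- Draw a uniformly random sample of `k` vertices. Without replacement, these are the first `k`
entries of a Fisher–Yates shuffle of `0, …, n - 1`. -/
def drawSample : Sampling → Cmd Reg Tab
  | .withReplacement =>
    .loop .i (var .k) <|
      .seq (.rand .r (var .n)) <|
      .put .sample (var .i) (const 0) (var .r)
  | .withoutReplacement =>
    .loop .i (var .k) <|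
      .seq (.rand .r (sub (var .n) (var .i))) <|
      .seq (.set .r (add (var .i) (var .r))) <|
      .seq (.set .v (get .swap (var .r) (const 0))) <|
      .seq (.when (eq (var .v) (const 0)) (.set .v (add (var .r) (const 1)))) <|
      .seq (.set .u (get .swap (var .i) (const 0))) <|
      .seq (.when (eq (var .u) (const 0)) (.set .u (add (var .i) (const 1)))) <|
      .seq (.put .swap (var .r) (const 0) (var .u)) <|
      .put .sample (var .i) (const 0) (sub (var .v) (const 1))

/-- Request all pairs with a vertex in the sample, each of them once. -/
def requestNeighbourhoods : Cmd Reg Tab :=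
  .loop .i (var .k) <|
    .seq (.set .v (get .sample (var .i) (const 0))) <|
    .when (eq (get .mark (var .v) (const 0)) (const 0)) <|
      .seq (.put .mark (var .v) (const 0) (const 1)) <|
      .loop .w (var .n) <|
        .when (eq (get .mark (var .w) (const 0)) (const 0)) <|
          .ask (var .v) (var .w)

/-- The querying phase. -/
def queryPhase (sampling : Sampling) : Cmd Reg Tab :=
  .seq computeK (.seq (drawSample sampling) requestNeighbourhoods)

/-- The clustering phase: the sampled vertices are considered in order; each one that is still
unclustered becomes a pivot and forms a cluster with its unclustered `+` neighbours. -/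
def clusterPhase : Cmd Reg Tab :=
  .loop .i (var .k) <|
    .seq (.set .v (get .sample (var .i) (const 0))) <|
    .when (eq (get .label (var .v) (const 0)) (const 0)) <|
      .loop .w (var .n) <|
        .when (and (eq (get .label (var .w) (const 0)) (const 0))
          (or (eq (var .w) (var .v)) (answer (var .v) (var .w)))) <|
          .put .label (var .w) (const 0) (add (var .i) (const 1))

/-- The initial configuration: the inputs are `n` and `Q`, everything else is `0`. -/
def init (n Q : ℕ) : Config Reg Tab where
  reg := fun x => match x with
    | .n => n
    | .Q => Q
    | _ => 0
  tab := fun _ _ _ => 0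
  answers := fun _ _ => 0
  requests := []
  time := 0

/-- Non-adaptive QECC on the graph `G` with query budget `Q`: the querying phase runs without any
access to `G`, then all its requests are answered at once, and then the clustering phase runs. -/
noncomputable def run (sampling : Sampling) {n : ℕ} (G : SimpleGraph (Fin n)) (Q : ℕ) :
    PMF (Config Reg Tab) :=
  ((queryPhase sampling).run (init n Q)).bind fun s => clusterPhase.run (s.answerRequests G)

/-- The clustering described by a final configuration: vertices with equal nonzero labels share a
cluster, and each vertex without a label is a singleton cluster. -/
def output (n : ℕ) (s : Config Reg Tab) (v : Fin n) : ℕ :=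
  if s.tab .label v 0 = 0 then 2 * v else 2 * s.tab .label v 0 + 1

end NAQECC

/-! ### Disagreements and bad triangles -/

section Combinatorics

open Finset

/-! Disagreements are counted over ordered pairs, so the target is 2·cost ≤ 6·OPT + n³/Q in
expectation. Only the draws are random, and the labels are a function `pivotLabels` of the sample.
It therefore suffices to follow a potential of the partial clustering along the draws. Let R be the
set of unlabelled vertices, e(R) the number of ordered adjacent pairs in it, and o an optimal
clustering.

Clusters: a pivot v ∈ R creates at most one disagreement for each pair of R that forms a bad
triangle with v (`closedCost_pivotStep_le`), and all these pairs leave R (`innerCost_pivotStep_le`).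
Since o disagrees with an edge of every bad triangle, summing over v ∈ R shows that three times the
disagreements of o removed from R pay for the new ones. So `closedCost + 3 * innerCost` does not
grow in mean (`sum_costPotential_le`).

Leftover edges: a pivot removes its neighbours from R, so |R| drops in mean by at least e(R)/n, and
n|R| + i·e(R) does not grow in mean (`sum_edgePotential_le`). It starts at n², and e(R) ≤ n|R|, so E
e(R) ≤ n²/(k+1) after k draws. Maximality of k gives Q ≤ (k+1)n when k < n; `exists_weight` treats k
= n.

Both ways of sampling fit one argument: given the past, the next vertex is uniform on a set that
contains R, and a labelled vertex changes nothing.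

Queries: at most n(n-1)/2 - (n-k)(n-k-1)/2 = (2n-1-k)k/2 ≤ Q pairs are requested. Time: each sampled
vertex costs O(n), and kn ≤ 3Q + 1. -/

open Classical in
/-- The indicator of a disagreement of the clustering `l` on the pair `x, y`. -/
noncomputable def disagreement {n : ℕ} (G : SimpleGraph (Fin n)) (l : Fin n → ℕ) (x y : Fin n) : ℕ :=
  if x ≠ y ∧ ¬(l x = l y ↔ G.Adj x y) then 1 else 0

theorem disagreement_comm {n : ℕ} (G : SimpleGraph (Fin n)) (l : Fin n → ℕ) (x y : Fin n) :
    disagreement G l x y = disagreement G l y x := by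
  have h := G.adj_comm x y
  have h1 : l x = l y ↔ l y = l x := eq_comm
  have h2 : x ≠ y ↔ y ≠ x := ne_comm
  unfold disagreement
  congr 1
  apply propext
  tauto

theorem disagreement_congr {n : ℕ} (G : SimpleGraph (Fin n)) {l m : Fin n → ℕ} {x y : Fin n}
    (h : l x = l y ↔ m x = m y) : disagreement G l x y = disagreement G m x y := by
  unfold disagreement
  congr 1
  rw [h]

theorem disagreement_self {n : ℕ} (G : SimpleGraph (Fin n)) (l : Fin n → ℕ) (x : Fin n) :
    disagreement G l x x = 0 := by
  simp [disagreement]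

/-- Summing over ordered pairs counts each disagreement twice. -/
theorem two_mul_clusteringCost {n : ℕ} (G : SimpleGraph (Fin n)) (l : Fin n → ℕ) :
    2 * clusteringCost G l = ∑ x, ∑ y, disagreement G l x y := by
  classical
  have h1 : clusteringCost G l = ∑ p : Fin n × Fin n with p.1 < p.2, disagreement G l p.1 p.2 := by
    unfold clusteringCost
    rw [← Finset.sum_filter_add_sum_filter_not (univ.filter fun p : Fin n × Fin n => p.1 < p.2)
      (fun p => l p.1 = l p.2), Finset.filter_filter, Finset.filter_filter]
    congr 1
    · refine Finset.sum_congr rfl fun p hp => ?_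
      simp only [mem_filter, mem_univ, true_and] at hp
      have := hp.1.ne
      by_cases h : G.Adj p.1 p.2 <;> simp [disagreement, similarity, h, hp.2, this]
    · refine Finset.sum_congr rfl fun p hp => ?_
      simp only [mem_filter, mem_univ, true_and] at hp
      have := hp.1.ne
      by_cases h : G.Adj p.1 p.2 <;> simp [disagreement, similarity, h, hp.2, this]
  have h2 : ∑ p : Fin n × Fin n with p.1 < p.2, disagreement G l p.1 p.2
      = ∑ p : Fin n × Fin n with p.2 < p.1, disagreement G l p.1 p.2 := by
    refine Finset.sum_nbij' Prod.swap Prod.swap ?_ ?_ ?_ ?_ ?_ <;> simp [disagreement_comm]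
  have h3 : ∑ x, ∑ y, disagreement G l x y = ∑ p : Fin n × Fin n, disagreement G l p.1 p.2 := by
    rw [← Finset.univ_product_univ, Finset.sum_product]
  have h4 : ∑ p : Fin n × Fin n with ¬ p.1 < p.2, disagreement G l p.1 p.2
      = ∑ p : Fin n × Fin n with p.2 < p.1, disagreement G l p.1 p.2 := by
    symm
    refine Finset.sum_subset (fun p hp => ?_) (fun p hp hp' => ?_)
    · simp only [mem_filter, mem_univ, true_and] at hp ⊢
      exact hp.not_gt
    · simp only [mem_filter, mem_univ, true_and] at hp hp'
      rw [le_antisymm (not_lt.1 hp') (not_lt.1 hp), disagreement_self]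
  rw [h3, ← Finset.sum_filter_add_sum_filter_not univ (fun p : Fin n × Fin n => p.1 < p.2), h4,
    ← h2, ← h1]
  ring

open Classical in
/-- The indicator of a triangle with exactly two `+` edges. -/
noncomputable def badTriangle {n : ℕ} (G : SimpleGraph (Fin n)) (v x y : Fin n) : ℕ :=
  if (G.Adj v x ∧ G.Adj v y ∧ ¬ G.Adj x y ∧ x ≠ y) ∨ (G.Adj v x ∧ G.Adj x y ∧ ¬ G.Adj v y ∧ v ≠ y) ∨
    (G.Adj v y ∧ G.Adj x y ∧ ¬ G.Adj v x ∧ v ≠ x) then 1 else 0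

theorem badTriangle_swap_left {n : ℕ} (G : SimpleGraph (Fin n)) (v x y : Fin n) :
    badTriangle G v x y = badTriangle G x v y := by
  unfold badTriangle
  have h := G.adj_comm v x
  have h' : v ≠ x ↔ x ≠ v := ne_comm
  congr 1
  apply propext
  tauto

theorem badTriangle_swap_right {n : ℕ} (G : SimpleGraph (Fin n)) (v x y : Fin n) :
    badTriangle G v x y = badTriangle G v y x := by
  unfold badTriangle
  have h := G.adj_comm x y
  have h' : x ≠ y ↔ y ≠ x := ne_comm
  congr 1
  apply propext
  tauto

/-- Every clustering disagrees with some edge of a bad triangle. -/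
theorem badTriangle_le {n : ℕ} (G : SimpleGraph (Fin n)) (l : Fin n → ℕ) (v x y : Fin n) :
    badTriangle G v x y ≤ badTriangle G v x y * disagreement G l x y +
      badTriangle G v x y * disagreement G l v x + badTriangle G v x y * disagreement G l v y := by
  rw [← mul_add, ← mul_add]
  by_cases hb : badTriangle G v x y = 0
  · simp [hb]
  refine Nat.le_mul_of_pos_right _ (Nat.pos_of_ne_zero fun h0 => hb ?_)
  simp only [add_eq_zero, disagreement, ite_eq_right_iff, one_ne_zero, imp_false, not_and,
    not_not] at h0
  obtain ⟨⟨h1, h2⟩, h3⟩ := h0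
  unfold badTriangle
  rw [if_neg]
  rintro (⟨a, b, c, d⟩ | ⟨a, b, c, d⟩ | ⟨a, b, c, d⟩)
  · exact c ((h1 d).1 (((h2 a.ne).2 a).symm.trans ((h3 b.ne).2 b)))
  · exact c ((h3 d).1 (((h2 a.ne).2 a).trans ((h1 b.ne).2 b)))
  · exact c ((h2 d).1 (((h3 a.ne).2 a).trans ((h1 b.ne).2 b).symm))

/-- The total number of bad triangles is at most three times the number of those whose edge
opposite to the distinguished vertex is a disagreement. -/
theorem sum_badTriangle_le {n : ℕ} (G : SimpleGraph (Fin n)) (l : Fin n → ℕ) (R : Finset (Fin n)) :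
    ∑ v ∈ R, ∑ x ∈ R, ∑ y ∈ R, badTriangle G v x y ≤
      3 * ∑ v ∈ R, ∑ x ∈ R, ∑ y ∈ R, badTriangle G v x y * disagreement G l x y := by
  -- A bad triangle is symmetric in its vertices, so renaming the summation variables shows that its
  -- three edges contribute equal totals.
  have h1 : ∑ v ∈ R, ∑ x ∈ R, ∑ y ∈ R, badTriangle G v x y * disagreement G l v y =
      ∑ v ∈ R, ∑ x ∈ R, ∑ y ∈ R, badTriangle G v x y * disagreement G l x y := by
    rw [Finset.sum_comm]
    refine Finset.sum_congr rfl fun x _ => Finset.sum_congr rfl fun v _ =>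
      Finset.sum_congr rfl fun y _ => ?_
    rw [badTriangle_swap_left]
  have h2 : ∑ v ∈ R, ∑ x ∈ R, ∑ y ∈ R, badTriangle G v x y * disagreement G l v x =
      ∑ v ∈ R, ∑ x ∈ R, ∑ y ∈ R, badTriangle G v x y * disagreement G l v y := by
    refine Finset.sum_congr rfl fun v _ => ?_
    rw [Finset.sum_comm]
    refine Finset.sum_congr rfl fun y _ => Finset.sum_congr rfl fun x _ => ?_
    rw [badTriangle_swap_right]
  calc _ ≤ ∑ v ∈ R, ∑ x ∈ R, ∑ y ∈ R, (badTriangle G v x y * disagreement G l x y +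
      badTriangle G v x y * disagreement G l v x + badTriangle G v x y * disagreement G l v y) :=
        Finset.sum_le_sum fun v _ => Finset.sum_le_sum fun x _ => Finset.sum_le_sum fun y _ =>
          badTriangle_le G l v x y
    _ = _ := by
        simp only [Finset.sum_add_distrib]
        rw [h2, h1]
        ring

/-! ### The pivot process -/

/-- The vertices without a cluster label. -/
def unlabelled {n : ℕ} (l : Fin n → ℕ) : Finset (Fin n) := {w | l w = 0}

@[simp] theorem mem_unlabelled {n : ℕ} {l : Fin n → ℕ} {w : Fin n} : w ∈ unlabelled l ↔ l w = 0 := by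
  simp [unlabelled]

open Classical in
/-- If `v` is unlabelled, give it and its unlabelled `+` neighbours the label `i + 1`. -/
noncomputable def pivotStep {n : ℕ} (G : SimpleGraph (Fin n)) (i : ℕ) (l : Fin n → ℕ) (v w : Fin n) :
    ℕ :=
  if l v = 0 ∧ l w = 0 ∧ (w = v ∨ G.Adj v w) then i + 1 else l w

/-- The ordered pairs of disagreement of a partial clustering, except those of unlabelled
vertices. -/
noncomputable def closedCost {n : ℕ} (G : SimpleGraph (Fin n)) (l : Fin n → ℕ) : ℕ :=
  ∑ x, ∑ y, if l x = 0 ∧ l y = 0 then 0 else disagreement G l x y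

/-- The ordered pairs of disagreement of a clustering inside a set. -/
noncomputable def innerCost {n : ℕ} (G : SimpleGraph (Fin n)) (l : Fin n → ℕ) (R : Finset (Fin n)) :
    ℕ :=
  ∑ x ∈ R, ∑ y ∈ R, disagreement G l x y

/-- The ordered pairs of adjacent vertices inside a set. -/
noncomputable def innerEdges {n : ℕ} (G : SimpleGraph (Fin n)) (R : Finset (Fin n)) : ℕ :=
  ∑ x ∈ R, ∑ y ∈ R, similarity G x y

theorem pivotStep_of_ne_zero {n : ℕ} (G : SimpleGraph (Fin n)) (i : ℕ) (l : Fin n → ℕ) {v : Fin n}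
    (hv : l v ≠ 0) : pivotStep G i l v = l := by
  funext w
  simp [pivotStep, hv]

theorem sum_unlabelled_unlabelled {n : ℕ} (l : Fin n → ℕ) (f : Fin n → Fin n → ℕ) :
    ∑ x ∈ unlabelled l, ∑ y ∈ unlabelled l, f x y =
      ∑ x, ∑ y, if l x = 0 ∧ l y = 0 then f x y else 0 := by
  simp only [unlabelled, Finset.sum_filter]
  refine Finset.sum_congr rfl fun x _ => ?_
  by_cases h : l x = 0 <;> simp [h]

/-- A newly closed disagreement is a `-` pair inside the new cluster or a `+` pair leaving it within
the unlabelled set; either way it completes a bad triangle with `v`. The bound `hl` makes the label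
`i + 1` fresh, so no old cluster is enlarged. -/
theorem closedCost_pivotStep_le {n : ℕ} (G : SimpleGraph (Fin n)) {i : ℕ} {l : Fin n → ℕ}
    (hl : ∀ w, l w ≤ i) {v : Fin n} (hv : l v = 0) :
    closedCost G (pivotStep G i l v) ≤
      closedCost G l + ∑ x ∈ unlabelled l, ∑ y ∈ unlabelled l, badTriangle G v x y := by
  classical
  rw [sum_unlabelled_unlabelled, closedCost, closedCost, ← Finset.sum_add_distrib]
  refine Finset.sum_le_sum fun x _ => ?_
  rw [← Finset.sum_add_distrib]
  refine Finset.sum_le_sum fun y _ => ?_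
  have hx := hl x
  have hy := hl y
  have q : ¬ 0 = i + 1 := by omega
  by_cases h1 : l x = 0 <;> by_cases h2 : l y = 0 <;>
  by_cases h3 : (x = v ∨ G.Adj v x) <;> by_cases h4 : (y = v ∨ G.Adj v y) <;>
  simp only [pivotStep, disagreement, hv, h1, h2, h3, h4, and_true, and_false,
    if_true, if_false, Nat.succ_ne_zero, zero_add, add_zero, le_refl, Nat.zero_le, q]
  · split_ifs with h5
    · obtain ⟨h5, h6⟩ := h5
      simp only [true_iff] at h6
      rw [badTriangle, if_pos]
      rcases h3 with rfl | h3
      · rcases h4 with rfl | h4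
        · exact absurd rfl h5
        · exact absurd h4 h6
      rcases h4 with rfl | h4
      · exact absurd h3.symm h6
      exact Or.inl ⟨h3, h4, h6, h5⟩
    · exact Nat.zero_le _
  · split_ifs with h5
    · obtain ⟨h5, h6⟩ := h5
      simp only [false_iff, not_not] at h6
      push Not at h4
      rw [badTriangle, if_pos]
      rcases h3 with rfl | h3
      · exact absurd h6 h4.2
      exact Or.inr (Or.inl ⟨h3, h6, h4.2, h4.1.symm⟩)
    · exact Nat.zero_le _
  · split_ifs with h5
    · obtain ⟨h5, h6⟩ := h5
      simp only [false_iff, not_not] at h6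
      push Not at h3
      rw [badTriangle, if_pos]
      rcases h4 with rfl | h4
      · exact absurd h6.symm h3.2
      exact Or.inr (Or.inr ⟨h4, h6, h3.2, h3.1.symm⟩)
    · exact Nat.zero_le _
  -- One end was labelled before and the other is labelled now: the pair was separated and stays so.
  all_goals
    have q1 : i + 1 ≠ l x := by omega
    have q2 : i + 1 ≠ l y := by omega
    simp [q1.symm, q2, eq_comm (a := 0), h2]

/-- A bad triangle has two `+` edges, so at least one of `x`, `y` is a `+` neighbour of `v` and the
pair leaves the unlabelled set. -/
theorem innerCost_pivotStep_le {n : ℕ} (G : SimpleGraph (Fin n)) (i : ℕ) {l : Fin n → ℕ}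
    (o : Fin n → ℕ) {v : Fin n} (hv : l v = 0) :
    (∑ x ∈ unlabelled l, ∑ y ∈ unlabelled l, badTriangle G v x y * disagreement G o x y) +
      innerCost G o (unlabelled (pivotStep G i l v)) ≤ innerCost G o (unlabelled l) := by
  classical
  rw [innerCost, innerCost, sum_unlabelled_unlabelled, sum_unlabelled_unlabelled,
    sum_unlabelled_unlabelled, ← Finset.sum_add_distrib]
  refine Finset.sum_le_sum fun x _ => ?_
  rw [← Finset.sum_add_distrib]
  refine Finset.sum_le_sum fun y _ => ?_
  by_cases h1 : l x = 0 <;> by_cases h2 : l y = 0 <;> simp only [pivotStep, hv, h1, h2, true_and,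
    and_true, and_false, false_and, if_true, if_false, zero_add, le_refl]
  have hb : badTriangle G v x y * disagreement G o x y ≤ disagreement G o x y := by
    refine (Nat.mul_le_mul_right _ (?_ : _ ≤ 1)).trans (one_mul _).le
    unfold badTriangle
    split_ifs <;> simp
  by_cases h3 : (x = v ∨ G.Adj v x) <;> by_cases h4 : (y = v ∨ G.Adj v y) <;>
    simp only [h3, h4, if_true, if_false, Nat.succ_ne_zero, and_true, and_false, add_zero]
  iterate 3 exact hb
  -- Both ends survive, so `v` has no `+` edge to either.
  have : badTriangle G v x y = 0 := by
    rw [badTriangle, if_neg]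
    tauto
  simp [this]

theorem unlabelled_pivotStep_subset {n : ℕ} (G : SimpleGraph (Fin n)) (i : ℕ) (l : Fin n → ℕ)
    (v : Fin n) : unlabelled (pivotStep G i l v) ⊆ unlabelled l := by
  intro w
  simp only [mem_unlabelled, pivotStep]
  split_ifs with h
  · simp
  · exact id

theorem innerEdges_mono {n : ℕ} (G : SimpleGraph (Fin n)) {R S : Finset (Fin n)} (h : R ⊆ S) :
    innerEdges G R ≤ innerEdges G S :=
  (Finset.sum_le_sum_of_subset h).trans
    (Finset.sum_le_sum fun _ _ => Finset.sum_le_sum_of_subset h)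

theorem innerEdges_le {n : ℕ} (G : SimpleGraph (Fin n)) (R : Finset (Fin n)) :
    innerEdges G R ≤ n * R.card := by
  have h : innerEdges G R ≤ ∑ x ∈ R, ∑ y ∈ R, 1 :=
    Finset.sum_le_sum fun x _ => Finset.sum_le_sum fun y _ => by
      unfold similarity; split_ifs <;> simp
  refine h.trans ?_
  simp only [sum_const, smul_eq_mul, mul_one]
  exact Nat.mul_le_mul_right _ ((Finset.card_le_univ R).trans (by simp))

theorem card_unlabelled_pivotStep {n : ℕ} (G : SimpleGraph (Fin n)) (i : ℕ) {l : Fin n → ℕ}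
    {v : Fin n} (hv : l v = 0) :
    (unlabelled (pivotStep G i l v)).card + ∑ y ∈ unlabelled l, similarity G v y ≤
      (unlabelled l).card := by
  classical
  have h : (∑ y ∈ unlabelled l, similarity G v y) = ((unlabelled l).filter fun y => G.Adj v y).card := by
    rw [Finset.card_filter]
    exact Finset.sum_congr rfl fun y _ => by simp [similarity]
  rw [h, ← Finset.card_union_of_disjoint]
  · refine Finset.card_le_card (Finset.union_subset ?_ (Finset.filter_subset _ _))
    exact unlabelled_pivotStep_subset G i l v
  · rw [Finset.disjoint_left]
    intro w h1 h2
    simp only [mem_filter, mem_unlabelled] at h1 h2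
    simp [pivotStep, hv, h2.1, h2.2] at h1

/-- The potential that accounts for the cost of the clusters. -/
noncomputable def costPotential {n : ℕ} (G : SimpleGraph (Fin n)) (o l : Fin n → ℕ) : ℕ :=
  closedCost G l + 3 * innerCost G o (unlabelled l)

/-- The potential that accounts for the edges between unlabelled vertices after `i` steps. -/
noncomputable def edgePotential {n : ℕ} (G : SimpleGraph (Fin n)) (i : ℕ) (l : Fin n → ℕ) : ℕ :=
  n * (unlabelled l).card + i * innerEdges G (unlabelled l)

/-- A candidate that is already labelled leaves the labels alone. Allowing any `A` between the
unlabelled set and all vertices covers both ways of sampling. -/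
theorem sum_eq_sum_unlabelled_add {n : ℕ} (G : SimpleGraph (Fin n)) (i : ℕ) {l : Fin n → ℕ}
    {A : Finset (Fin n)} (hA : unlabelled l ⊆ A) (F : (Fin n → ℕ) → ℕ) :
    ∑ v ∈ A, F (pivotStep G i l v) =
      ∑ v ∈ unlabelled l, F (pivotStep G i l v) + (A.card - (unlabelled l).card) * F l := by
  classical
  rw [← Finset.sum_sdiff hA, add_comm, ← Finset.card_sdiff_of_subset hA]
  congr 1
  rw [Finset.sum_congr rfl (g := fun _ => F l), sum_const, smul_eq_mul]
  intro v hv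
  rw [pivotStep_of_ne_zero]
  simpa using (Finset.mem_sdiff.1 hv).2

/-- Over unlabelled pivots, the total growth of `closedCost` is at most the number of bad triangles,
and three times the total drop of `innerCost` is at least that number. -/
theorem sum_costPotential_le {n : ℕ} (G : SimpleGraph (Fin n)) {i : ℕ} (o : Fin n → ℕ) {l : Fin n → ℕ}
    (hl : ∀ w, l w ≤ i) {A : Finset (Fin n)} (hA : unlabelled l ⊆ A) :
    ∑ v ∈ A, costPotential G o (pivotStep G i l v) ≤ A.card * costPotential G o l := by
  rw [sum_eq_sum_unlabelled_add G i hA (costPotential G o)]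
  have hc := Finset.card_le_card hA
  have key : ∑ v ∈ unlabelled l, costPotential G o (pivotStep G i l v) ≤
      (unlabelled l).card * costPotential G o l := by
    have h1 : ∑ v ∈ unlabelled l, closedCost G (pivotStep G i l v) ≤
        ∑ v ∈ unlabelled l, (closedCost G l +
          ∑ x ∈ unlabelled l, ∑ y ∈ unlabelled l, badTriangle G v x y) :=
      Finset.sum_le_sum fun v hv => closedCost_pivotStep_le G hl (mem_unlabelled.1 hv)
    have h2 : ∑ v ∈ unlabelled l, ((∑ x ∈ unlabelled l, ∑ y ∈ unlabelled l,
          badTriangle G v x y * disagreement G o x y) +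
          innerCost G o (unlabelled (pivotStep G i l v))) ≤
        ∑ v ∈ unlabelled l, innerCost G o (unlabelled l) :=
      Finset.sum_le_sum fun v hv => innerCost_pivotStep_le G i o (mem_unlabelled.1 hv)
    have h3 := sum_badTriangle_le G o (unlabelled l)
    simp only [costPotential, Finset.sum_add_distrib, ← Finset.mul_sum, sum_const,
      smul_eq_mul, mul_add] at h1 h2 ⊢
    rw [mul_left_comm]
    omega
  calc _ ≤ (unlabelled l).card * costPotential G o l +
        (A.card - (unlabelled l).card) * costPotential G o l := Nat.add_le_add_right key _
    _ = _ := by rw [← add_mul, Nat.add_sub_cancel' hc]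

/-- The extra `innerEdges` incurred when the coefficient passes from `i` to `i + 1` is paid by the
drop in `n * card`: summed over pivots, at least `innerEdges` vertices disappear, and `A.card ≤ n`.
-/
theorem sum_edgePotential_le {n : ℕ} (G : SimpleGraph (Fin n)) (i : ℕ) {l : Fin n → ℕ}
    {A : Finset (Fin n)} (hA : unlabelled l ⊆ A) :
    ∑ v ∈ A, edgePotential G (i + 1) (pivotStep G i l v) ≤ A.card * edgePotential G i l := by
  have h1 : ∑ v ∈ A, (unlabelled (pivotStep G i l v)).card + innerEdges G (unlabelled l) ≤
      A.card * (unlabelled l).card := by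
    rw [sum_eq_sum_unlabelled_add G i hA (fun l => (unlabelled l).card)]
    have hc := Finset.card_le_card hA
    have : ∑ v ∈ unlabelled l, ((unlabelled (pivotStep G i l v)).card +
        ∑ y ∈ unlabelled l, similarity G v y) ≤ ∑ v ∈ unlabelled l, (unlabelled l).card :=
      Finset.sum_le_sum fun v hv => card_unlabelled_pivotStep G i (mem_unlabelled.1 hv)
    rw [Finset.sum_add_distrib, sum_const, smul_eq_mul] at this
    have h2 : (unlabelled l).card * (unlabelled l).card +
        (A.card - (unlabelled l).card) * (unlabelled l).card = A.card * (unlabelled l).card := by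
      rw [← add_mul, Nat.add_sub_cancel' hc]
    unfold innerEdges
    omega
  have h2 : ∑ v ∈ A, innerEdges G (unlabelled (pivotStep G i l v)) ≤
      A.card * innerEdges G (unlabelled l) := by
    rw [← smul_eq_mul, ← sum_const]
    exact Finset.sum_le_sum fun v _ => innerEdges_mono G (unlabelled_pivotStep_subset G i l v)
  have h3 : A.card * innerEdges G (unlabelled l) ≤ n * innerEdges G (unlabelled l) :=
    Nat.mul_le_mul_right _ ((Finset.card_le_univ A).trans (by simp))
  simp only [edgePotential, Finset.sum_add_distrib, ← Finset.mul_sum]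
  nlinarith [Nat.mul_le_mul_left n h1, Nat.mul_le_mul_left (i + 1) h2]

/-- The labels after the first `i` vertices of the sequence `p` have been considered. -/
noncomputable def pivotLabels {n : ℕ} (G : SimpleGraph (Fin n)) (p : ℕ → ℕ) : ℕ → Fin n → ℕ
  | 0 => fun _ => 0
  | i + 1 => if h : p i < n then pivotStep G i (pivotLabels G p i) ⟨p i, h⟩ else pivotLabels G p i

theorem pivotLabels_congr {n : ℕ} (G : SimpleGraph (Fin n)) {p q : ℕ → ℕ} {i : ℕ}
    (h : ∀ j < i, p j = q j) : pivotLabels G p i = pivotLabels G q i := by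
  induction i with
  | zero => rfl
  | succ i ih =>
    simp only [pivotLabels, h i (Nat.lt_succ_self i), ih fun j hj => h j (hj.trans (Nat.lt_succ_self i))]

theorem pivotLabels_le {n : ℕ} (G : SimpleGraph (Fin n)) (p : ℕ → ℕ) (i : ℕ) (w : Fin n) :
    pivotLabels G p i w ≤ i := by
  induction i with
  | zero => exact le_rfl
  | succ i ih =>
    simp only [pivotLabels]
    split_ifs with h
    · unfold pivotStep
      split_ifs <;> omega
    · omega

/-- A vertex that has been considered either had a label or became a pivot. Hence unlabelled
vertices are unsampled, a fact needed both for the averaging and for the availability of answers. -/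
theorem pivotLabels_ne_zero {n : ℕ} (G : SimpleGraph (Fin n)) {p : ℕ → ℕ} {i j : ℕ} (hj : j < i)
    {w : Fin n} (hw : p j = w) : pivotLabels G p i w ≠ 0 := by
  induction i with
  | zero => omega
  | succ i ih =>
    simp only [pivotLabels]
    rcases Nat.lt_succ_iff_lt_or_eq.1 hj with h | rfl
    · have := ih h
      split_ifs with h'
      · simp [pivotStep, this]
      · exact this
    · have e : (⟨p j, hw ▸ w.2⟩ : Fin n) = w := Fin.ext hw
      rw [dif_pos (hw ▸ w.2), e]
      by_cases h0 : pivotLabels G p j w = 0 <;> simp [pivotStep, h0]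

/-- The cost of a partial clustering whose unlabelled vertices become singletons. -/
theorem two_mul_clusteringCost_of_labels {n : ℕ} (G : SimpleGraph (Fin n)) (l : Fin n → ℕ) :
    2 * clusteringCost G (fun v => if l v = 0 then 2 * (v : ℕ) else 2 * l v + 1) =
      closedCost G l + innerEdges G (unlabelled l) := by
  rw [two_mul_clusteringCost, innerEdges, sum_unlabelled_unlabelled, closedCost,
    ← Finset.sum_add_distrib]
  refine Finset.sum_congr rfl fun x _ => ?_
  rw [← Finset.sum_add_distrib]
  refine Finset.sum_congr rfl fun y _ => ?_
  by_cases h : x = y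
  · subst h
    simp [disagreement_self, similarity]
  have h' : (x : ℕ) ≠ y := fun e => h (Fin.ext e)
  by_cases h0 : l x = 0 ∧ l y = 0
  · rw [disagreement_congr G (m := fun v => (v : ℕ)) (by simp [h0])]
    rw [if_pos h0, if_pos h0, zero_add]
    unfold disagreement similarity
    congr 1
    simp [h, h']
  · rw [if_neg h0, if_neg h0, add_zero]
    -- Clusters get odd identifiers and singletons even ones, so they never collide.
    exact disagreement_congr G (by split_ifs <;> omega)

theorem costPotential_zero {n : ℕ} (G : SimpleGraph (Fin n)) (o : Fin n → ℕ) :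
    costPotential G o (fun _ => 0) = 3 * (2 * clusteringCost G o) := by
  simp [costPotential, closedCost, innerCost, unlabelled, two_mul_clusteringCost]

theorem edgePotential_zero {n : ℕ} (G : SimpleGraph (Fin n)) :
    edgePotential G 0 (fun _ => 0) = n ^ 2 := by
  simp [edgePotential, unlabelled, sq]

theorem exists_clusteringCost_eq_optCost {n : ℕ} (G : SimpleGraph (Fin n)) :
    ∃ o, clusteringCost G o = optCost G :=
  Nat.sInf_mem (Set.range_nonempty (clusteringCost G))

end Combinatorics

/-! ### Expectations and support-based program logic -/

section Expectation

variable {σ ρ : Type}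

theorem expectedValue_pure (s : σ) (f : σ → ℝ≥0∞) : expectedValue (PMF.pure s) f = f s := by
  rw [expectedValue, tsum_eq_single s (fun t ht => by simp [PMF.pure_apply, ht])]
  simp

theorem expectedValue_mono {p : PMF σ} {f g : σ → ℝ≥0∞} (h : ∀ s ∈ p.support, f s ≤ g s) :
    expectedValue p f ≤ expectedValue p g := by
  refine ENNReal.tsum_le_tsum fun s => ?_
  by_cases hs : s ∈ p.support
  · exact mul_le_mul_right (h s hs) _
  · rw [PMF.mem_support_iff, not_not] at hs
    simp [hs]

theorem expectedValue_const (p : PMF σ) (b : ℝ≥0∞) : expectedValue p (fun _ => b) = b := by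
  rw [expectedValue, ENNReal.tsum_mul_right, p.tsum_coe, one_mul]

theorem expectedValue_const_mul (p : PMF σ) (b : ℝ≥0∞) (f : σ → ℝ≥0∞) :
    expectedValue p (fun s => b * f s) = b * expectedValue p f := by
  simp only [expectedValue, ← ENNReal.tsum_mul_left, mul_left_comm]

theorem expectedValue_bind (p : PMF σ) (q : σ → PMF ρ) (f : ρ → ℝ≥0∞) :
    expectedValue (p.bind q) f = expectedValue p fun s => expectedValue (q s) f := by
  simp only [expectedValue, PMF.bind_apply, ← ENNReal.tsum_mul_right, ← ENNReal.tsum_mul_left]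
  rw [ENNReal.tsum_comm]
  simp only [mul_assoc]

theorem expectedValue_le_of_support {p : PMF σ} {f : σ → ℝ≥0∞} {b : ℝ≥0∞}
    (h : ∀ s ∈ p.support, f s ≤ b) : expectedValue p f ≤ b :=
  (expectedValue_mono h).trans (expectedValue_const p b).le

/-- Lets the phases after the sampling be treated through their possible outcomes only, leaving the
expectation to the draws. -/
theorem expectedValue_bind_le {p : PMF σ} {q : σ → PMF ρ} {f : ρ → ℝ≥0∞} {g : σ → ℝ≥0∞}
    (h : ∀ s ∈ p.support, ∀ t ∈ (q s).support, f t ≤ g s) :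
    expectedValue (p.bind q) f ≤ expectedValue p g := by
  rw [expectedValue_bind]
  exact expectedValue_mono fun s hs => expectedValue_le_of_support (h s hs)

theorem expectedValue_map (p : PMF σ) (q : σ → ρ) (f : ρ → ℝ≥0∞) :
    expectedValue (p.map q) f = expectedValue p (f ∘ q) := by
  rw [← PMF.bind_pure_comp, expectedValue_bind]
  simp only [Function.comp_apply, expectedValue_pure]
  rfl

theorem uniformBelow_of_pos {m : ℕ} (hm : 0 < m) :
    uniformBelow m = PMF.uniformOfFinset (Finset.range m) (Finset.nonempty_range_iff.2 hm.ne') :=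
  dif_pos hm

theorem expectedValue_uniformBelow {m : ℕ} (hm : 0 < m) (f : ℕ → ℝ≥0∞) :
    expectedValue (uniformBelow m) f = (∑ r ∈ Finset.range m, f r) / m := by
  rw [expectedValue, tsum_eq_sum (s := Finset.range m)]
  · rw [ENNReal.div_eq_inv_mul, Finset.mul_sum]
    refine Finset.sum_congr rfl fun r hr => ?_
    rw [uniformBelow_of_pos hm, PMF.uniformOfFinset_apply_of_mem _ hr, Finset.card_range]
  · intro r hr
    rw [uniformBelow_of_pos hm, PMF.uniformOfFinset_apply_of_notMem _ hr, zero_mul]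

theorem mem_support_uniformBelow {m r : ℕ} (h : r ∈ (uniformBelow m).support) : r < m ∨ m = 0 := by
  rcases Nat.eq_zero_or_pos m with hm | hm
  · exact Or.inr hm
  · rw [uniformBelow_of_pos hm, PMF.mem_support_uniformOfFinset_iff] at h
    exact Or.inl (Finset.mem_range.1 h)

/-- An invariant of a counting loop. -/
theorem support_iterateFor {f : ℕ → σ → PMF σ} {I : ℕ → σ → Prop} {m : ℕ}
    (hf : ∀ i < m, ∀ s, I i s → ∀ t ∈ (f i s).support, I (i + 1) t) {s : σ} (h0 : I 0 s) :
    ∀ t ∈ (iterateFor f m s).support, I m t := by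
  induction m with
  | zero =>
    intro t ht
    simp only [iterateFor, PMF.support_pure, Set.mem_singleton_iff] at ht
    exact ht ▸ h0
  | succ m ih =>
    intro t ht
    simp only [iterateFor, PMF.mem_support_bind_iff] at ht
    obtain ⟨u, hu, ht⟩ := ht
    exact hf m (Nat.lt_succ_self m) u
      (ih (fun i hi => hf i (hi.trans (Nat.lt_succ_self m))) u hu) t ht

/-- A potential that does not increase in expectation along a counting loop. -/
theorem expectedValue_iterateFor_le {f : ℕ → σ → PMF σ} {I : ℕ → σ → Prop} {φ : ℕ → σ → ℝ≥0∞}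
    {m : ℕ} (hf : ∀ i < m, ∀ s, I i s → ∀ t ∈ (f i s).support, I (i + 1) t)
    (hφ : ∀ i < m, ∀ s, I i s → expectedValue (f i s) (φ (i + 1)) ≤ φ i s) {s : σ} (h0 : I 0 s) :
    expectedValue (iterateFor f m s) (φ m) ≤ φ 0 s := by
  induction m with
  | zero => simp [iterateFor, expectedValue_pure]
  | succ m ih =>
    have hf' := fun i (hi : i < m) => hf i (hi.trans (Nat.lt_succ_self m))
    rw [iterateFor, expectedValue_bind]
    refine (expectedValue_mono fun u hu => ?_).trans
      (ih hf' fun i hi => hφ i (hi.trans (Nat.lt_succ_self m)))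
    exact hφ m (Nat.lt_succ_self m) u (support_iterateFor hf' h0 u hu)

end Expectation

/-! ### Proof rules for all possible outcomes of a command -/

section ProgramLogic

variable {ι τ : Type} [DecidableEq ι] [DecidableEq τ]

/-- Every possible final configuration of the command satisfies `P`. -/
def Ensures (c : Cmd ι τ) (s : Config ι τ) (P : Config ι τ → Prop) : Prop :=
  ∀ t ∈ (c.run s).support, P t

theorem Ensures.mono {c : Cmd ι τ} {s : Config ι τ} {P P' : Config ι τ → Prop}
    (h : Ensures c s P) (hP : ∀ t, P t → P' t) : Ensures c s P' :=
  fun t ht => hP t (h t ht)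

theorem ensures_seq {c d : Cmd ι τ} {s : Config ι τ} {P : Config ι τ → Prop} :
    Ensures (.seq c d) s P ↔ Ensures c s fun t => Ensures d t P := by
  simp only [Ensures, Cmd.run, PMF.mem_support_bind_iff]
  exact ⟨fun h t ht u hu => h u ⟨t, ht, hu⟩, fun h u ⟨t, ht, hu⟩ => h t ht u hu⟩

theorem ensures_set {x : ι} {a : Expr ι τ} {s : Config ι τ} {P : Config ι τ → Prop} :
    Ensures (.set x a) s P ↔ P ((s.setReg x (a.eval s)).tick (a.steps + 1)) := by
  simp [Ensures, Cmd.run]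

theorem ensures_put {t : τ} {a b c : Expr ι τ} {s : Config ι τ} {P : Config ι τ → Prop} :
    Ensures (.put t a b c) s P ↔
      P ((s.setTab t (a.eval s) (b.eval s) (c.eval s)).tick (a.steps + b.steps + c.steps + 1)) := by
  simp [Ensures, Cmd.run]

theorem ensures_ask {a b : Expr ι τ} {s : Config ι τ} {P : Config ι τ → Prop} :
    Ensures (.ask a b) s P ↔
      P ((s.addRequest (a.eval s) (b.eval s)).tick (a.steps + b.steps + 1)) := by
  simp [Ensures, Cmd.run]

theorem ensures_when {a : Expr ι τ} {c : Cmd ι τ} {s : Config ι τ} {P : Config ι τ → Prop} :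
    Ensures (.when a c) s P ↔
      (a.eval s ≠ 0 → Ensures c (s.tick (a.steps + 1)) P) ∧
        (a.eval s = 0 → P (s.tick (a.steps + 1))) := by
  by_cases h : a.eval s = 0 <;> simp [Ensures, Cmd.run, h]

theorem ensures_rand {x : ι} {a : Expr ι τ} {s : Config ι τ} {P : Config ι τ → Prop}
    (h : ∀ r, r < a.eval s ∨ a.eval s = 0 → P ((s.setReg x r).tick (a.steps + 1))) :
    Ensures (.rand x a) s P := by
  intro t ht
  simp only [Cmd.run, PMF.mem_support_map_iff] at ht
  obtain ⟨r, hr, rfl⟩ := ht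
  exact h r (mem_support_uniformBelow hr)

theorem ensures_loop {x : ι} {a : Expr ι τ} {c : Cmd ι τ} {s : Config ι τ}
    {P : Config ι τ → Prop} (I : ℕ → Config ι τ → Prop) (h0 : I 0 (s.tick (a.steps + 1)))
    (hI : ∀ i < a.eval s, ∀ t, I i t → Ensures c ((t.setReg x i).tick 1) (I (i + 1)))
    (hP : ∀ t, I (a.eval s) t → P t) : Ensures (.loop x a c) s P := by
  intro t ht
  exact hP t (support_iterateFor (I := I) (fun i hi u hu => hI i hi u hu) h0 t ht)

/-- A command that starts with a uniform draw preserves a potential if the average over the draws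
does not exceed it. -/
theorem expectedValue_rand_seq_le {x : ι} {a : Expr ι τ} {c : Cmd ι τ} {s : Config ι τ}
    {f : Config ι τ → ℝ≥0∞} {b : ℝ≥0∞} (h : ℕ → ℝ≥0∞) (ha : 0 < a.eval s)
    (hc : ∀ r < a.eval s, Ensures c ((s.setReg x r).tick (a.steps + 1)) fun t => f t ≤ h r)
    (hb : ∑ r ∈ Finset.range (a.eval s), h r ≤ a.eval s * b) :
    expectedValue ((Cmd.seq (.rand x a) c).run s) f ≤ b := by
  rw [Cmd.run, expectedValue_bind, Cmd.run, expectedValue_map, expectedValue_uniformBelow ha]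
  refine ENNReal.div_le_of_le_mul' (le_trans (Finset.sum_le_sum fun r hr => ?_) hb)
  exact expectedValue_le_of_support (hc r (Finset.mem_range.1 hr))

end ProgramLogic

namespace NAQECC

open Expr Cmd

/-! ### The number of sampled vertices -/

/-- `max {t ≤ n ∣ (2 n - 1 - t) t ≤ 2 Q}`. -/
def sampleSize (n Q : ℕ) : ℕ := Nat.findGreatest (fun t => (2 * n - 1 - t) * t ≤ 2 * Q) n

theorem sampleSize_le (n Q : ℕ) : sampleSize n Q ≤ n := Nat.findGreatest_le n

theorem sampleSize_spec (n Q : ℕ) : (2 * n - 1 - sampleSize n Q) * sampleSize n Q ≤ 2 * Q :=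
  Nat.findGreatest_spec (P := fun t => (2 * n - 1 - t) * t ≤ 2 * Q) (Nat.zero_le n) (by simp)

theorem le_sampleSize {n Q t : ℕ} (h : t ≤ n) (ht : (2 * n - 1 - t) * t ≤ 2 * Q) :
    t ≤ sampleSize n Q :=
  Nat.le_findGreatest h ht

/-- If `t ≥ Q + 2`, then `2 * n - 1 - t ≥ t - 1 ≥ Q + 1` because `t ≤ n`, and the product is at
least `(Q + 1) * (Q + 2) > 2 * Q`. This justifies the range of the loop in `computeK`. -/
theorem le_succ_of_admissible {n Q t : ℕ} (h : t ≤ n) (ht : (2 * n - 1 - t) * t ≤ 2 * Q) :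
    t ≤ Q + 1 := by
  by_contra hlt
  have h1 : t - 1 ≤ 2 * n - 1 - t := by omega
  have h2 : (Q + 1) * (Q + 2) ≤ (2 * n - 1 - t) * t := Nat.mul_le_mul (by omega) (by omega)
  nlinarith

theorem sampleSize_le_succ (n Q : ℕ) : sampleSize n Q ≤ Q + 1 :=
  le_succ_of_admissible (sampleSize_le n Q) (sampleSize_spec n Q)

/-- Since the sample size k is at most n, the factor `2 * n - 1 - k` is at least `n - 1`, so (n-1)k
≤ 2Q; adding k ≤ Q + 1 gives the bound. It turns O(n) work per sampled vertex into O(Q) in all. -/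
theorem sampleSize_mul_le {n Q : ℕ} : sampleSize n Q * n ≤ 3 * Q + 1 := by
  have h1 := sampleSize_le n Q
  have h2 := sampleSize_spec n Q
  have h3 := sampleSize_le_succ n Q
  rcases Nat.eq_zero_or_pos n with rfl | hn
  · simp
  have h4 : (n - 1) * sampleSize n Q ≤ (2 * n - 1 - sampleSize n Q) * sampleSize n Q :=
    Nat.mul_le_mul_right _ (by omega)
  have h5 : sampleSize n Q * n = (n - 1) * sampleSize n Q + sampleSize n Q := by
    obtain ⟨m, rfl⟩ : ∃ m, n = m + 1 := ⟨n - 1, by omega⟩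
    simp only [Nat.add_sub_cancel]
    ring
  omega

/-- Otherwise `sampleSize n Q + 1` would be admissible too, against maximality. -/
theorem le_succ_sampleSize_mul {n Q : ℕ} (h : sampleSize n Q < n) :
    Q ≤ (sampleSize n Q + 1) * n := by
  by_contra hlt
  push Not at hlt
  have h1 : (2 * n - 1 - (sampleSize n Q + 1)) * (sampleSize n Q + 1) ≤
      (2 * n) * (sampleSize n Q + 1) := Nat.mul_le_mul_right _ (by omega)
  have := le_sampleSize (n := n) (Q := Q) (t := sampleSize n Q + 1) h (by nlinarith)
  omega

/-- The configurations in which the sample size has been computed. -/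
structure Sized (n Q : ℕ) (s : Config Reg Tab) : Prop where
  reg_n : s.reg .n = n
  reg_k : s.reg .k = sampleSize n Q
  tab : ∀ t a b, s.tab t a b = 0
  requests : s.requests = []
  time : s.time ≤ 21 * Q + 46

theorem ensures_computeK (n Q : ℕ) : Ensures computeK (init n Q) (Sized n Q) := by
  -- The register `k` is admissible-bounded from above and dominates every admissible value tried so
  -- far. One round costs at most 1 + 4 + 14 + 2 = 21 steps, and entering the loop costs 4.
  refine ensures_loop (fun i s => s.reg .n = n ∧ s.reg .Q = Q ∧ s.reg .k ≤ sampleSize n Q ∧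
    (∀ t < i, t ≤ n → (2 * n - 1 - t) * t ≤ 2 * Q → t ≤ s.reg .k) ∧
    (∀ t a b, s.tab t a b = 0) ∧ s.requests = [] ∧ s.time ≤ 21 * i + 4) ?_ ?_ ?_
  · simp [init, Config.tick, Expr.steps]
  · rintro i - s ⟨h1, h2, h3, h4, h5, h6, h7⟩
    have key : ∀ t < i + 1, t ≤ n → (2 * n - 1 - t) * t ≤ 2 * Q → t ≤ i := fun t ht _ _ => by omega
    simp only [ensures_when, ensures_set, Config.tick, Config.setReg, Expr.eval, Expr.steps,
      Function.update_apply, reduceCtorEq, if_true, if_false, h1, h2, h5, h6, ne_eq, ite_eq_right_iff,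
      one_ne_zero, imp_false, implies_true, true_and, Nat.not_le, not_lt]
    refine ⟨fun hn => ⟨fun hQ => ⟨le_sampleSize hn hQ, key, by omega⟩, fun hQ =>
      ⟨h3, fun t ht h8 h9 => ?_, by omega⟩⟩, fun hn => ⟨h3, fun t ht h8 h9 => ?_, by omega⟩⟩
    all_goals
      rcases Nat.lt_succ_iff_lt_or_eq.1 ht with h | rfl
      · exact h4 t h h8 h9
      · omega
  · rintro s ⟨h1, h2, h3, h4, h5, h6, h7⟩
    simp only [Expr.eval, init] at h4 h7
    refine ⟨h1, le_antisymm h3 (h4 _ ?_ (sampleSize_le n Q) (sampleSize_spec n Q)), h5, h6, by omega⟩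
    have := sampleSize_le_succ n Q
    omega

/-! ### Drawing the sample -/

/-- The number of choices for the next vertex of the sample. -/
def choices : Sampling → Expr Reg Tab
  | .withReplacement => var .n
  | .withoutReplacement => sub (var .n) (var .i)

/-- Storing the next vertex of the sample after the random choice. -/
def storeChoice : Sampling → Cmd Reg Tab
  | .withReplacement => .put .sample (var .i) (const 0) (var .r)
  | .withoutReplacement =>
      .seq (.set .r (add (var .i) (var .r))) <|
      .seq (.set .v (get .swap (var .r) (const 0))) <|
      .seq (.when (eq (var .v) (const 0)) (.set .v (add (var .r) (const 1)))) <|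
      .seq (.set .u (get .swap (var .i) (const 0))) <|
      .seq (.when (eq (var .u) (const 0)) (.set .u (add (var .i) (const 1)))) <|
      .seq (.put .swap (var .r) (const 0) (var .u)) <|
      .put .sample (var .i) (const 0) (sub (var .v) (const 1))

theorem drawSample_eq (sampling : Sampling) : drawSample sampling =
    .loop .i (var .k) (.seq (.rand .r (choices sampling)) (storeChoice sampling)) := by
  cases sampling <;> rfl

/-- The vertices sampled. -/
def samples (s : Config Reg Tab) (j : ℕ) : ℕ := s.tab .sample j 0

/-- The entry at position `j` of the shuffled list. -/
def entry (s : Config Reg Tab) (j : ℕ) : ℕ := if s.tab .swap j 0 = 0 then j else s.tab .swap j 0 - 1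

/-- The positions `i, …, n - 1` of the shuffled list hold the vertices not sampled so far. -/
structure Shuffled (n i : ℕ) (s : Config Reg Tab) : Prop where
  lt : ∀ j, i ≤ j → j < n → entry s j < n
  inj : ∀ j, i ≤ j → j < n → ∀ j', i ≤ j' → j' < n → entry s j = entry s j' → j = j'
  cover : ∀ x < n, (∃ j < i, samples s j = x) ∨ ∃ j, i ≤ j ∧ j < n ∧ entry s j = x

/-- The configurations in which `i` vertices have been drawn. -/
structure Drawn (sampling : Sampling) (n K T i : ℕ) (s : Config Reg Tab) : Prop where
  reg_n : s.reg .n = n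
  reg_k : s.reg .k = K
  mark : ∀ a b, s.tab .mark a b = 0
  label : ∀ a b, s.tab .label a b = 0
  requests : s.requests = []
  lt : ∀ j < i, samples s j < n
  time : s.time ≤ T + 60 * i
  shuffled : sampling = .withoutReplacement → Shuffled n i s

/-- The vertex that corresponds to a random choice. -/
def chosen : Sampling → Config Reg Tab → ℕ → ℕ → ℕ
  | .withReplacement, _, _, r => r
  | .withoutReplacement, s, i, r => entry s (i + r)

/-- The number of choices in a configuration with `i` vertices drawn. -/
def choiceCount : Sampling → ℕ → ℕ → ℕ
  | .withReplacement, n, _ => n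
  | .withoutReplacement, n, i => n - i

/-- The effect of storing a choice. -/
structure Stored (sampling : Sampling) (n K T i : ℕ) (s : Config Reg Tab) (r : ℕ)
    (t : Config Reg Tab) : Prop where
  drawn : Drawn sampling n K T (i + 1) t
  new : samples t i = chosen sampling s i r
  old : ∀ j < i, samples t j = samples s j

theorem chosen_lt {sampling : Sampling} {n K T i r : ℕ} {s : Config Reg Tab}
    (hs : Drawn sampling n K T i s) (hr : r < choiceCount sampling n i) :
    chosen sampling s i r < n := by
  cases sampling with
  | withReplacement => exact hr
  | withoutReplacement =>
    simp only [choiceCount] at hr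
    exact (hs.shuffled rfl).lt _ (by omega) (by omega)

/-- The entry at `i` moves to position `i + r`, whose old entry is the vertex drawn. Position `i` is
never read again, so nothing has to be written there. -/
theorem Shuffled.next {n i r : ℕ} {s t : Config Reg Tab} (hs : Shuffled n i s) (hr : r < n - i)
    (hnew : samples t i = entry s (i + r)) (hold : ∀ j < i, samples t j = samples s j)
    (hentry : ∀ j, entry t j = if j = i + r then entry s i else entry s j) : Shuffled n (i + 1) t where
  lt j h1 h2 := by
    rw [hentry]
    split_ifs
    · exact hs.lt i le_rfl (by omega)
    · exact hs.lt j (by omega) h2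
  inj j h1 h2 j' h1' h2' h := by
    rw [hentry, hentry] at h
    split_ifs at h with h3 h4 h4
    · omega
    · have := hs.inj i le_rfl (by omega) j' (by omega) h2' h
      omega
    · have := hs.inj j (by omega) h2 i le_rfl (by omega) h
      omega
    · exact hs.inj j (by omega) h2 j' (by omega) h2' h
  cover x hx := by
    rcases hs.cover x hx with ⟨j, hj, h⟩ | ⟨j, h1, h2, h⟩
    · exact Or.inl ⟨j, by omega, by rw [hold j hj, h]⟩
    · by_cases h3 : j = i + r
      · exact Or.inl ⟨i, by omega, by rw [hnew, ← h3, h]⟩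
      · right
        by_cases h4 : j = i
        · exact ⟨i + r, by omega, by omega, by rw [hentry, if_pos rfl, ← h4, h]⟩
        · exact ⟨j, by omega, h2, by rw [hentry, if_neg h3, h]⟩

theorem ensures_storeChoice {sampling : Sampling} {n K T i r : ℕ} {s : Config Reg Tab}
    (hs : Drawn sampling n K T i s) (hr : r < choiceCount sampling n i) :
    Ensures (storeChoice sampling)
      ((((s.setReg .i i).tick 1).setReg .r r).tick ((choices sampling).steps + 1))
      (Stored sampling n K T i s r) := by
  have hlt := chosen_lt hs hr
  obtain ⟨h1, h2, h3, h4, h5, h6, h7, h8⟩ := hs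
  cases sampling with
  | withReplacement =>
    simp only [storeChoice, choices, ensures_put]
    have new : ∀ j, samples ((((((s.setReg .i i).tick 1).setReg .r r).tick
        ((var Reg.n : Expr Reg Tab).steps + 1)).setTab .sample i 0 r).tick 4) j =
        if j = i then r else samples s j := by
      intro j
      by_cases h : j = i <;>
      simp [samples, Config.tick, Config.setReg, Config.setTab, h]
    refine ⟨⟨?_, ?_, ?_, ?_, ?_, fun j hj => ?_, ?_, ?_⟩, ?_, fun j hj => ?_⟩
    · simpa [Config.tick, Config.setReg, Config.setTab, Function.update_apply] using h1
    · simpa [Config.tick, Config.setReg, Config.setTab, Function.update_apply] using h2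
    · simpa [Config.tick, Config.setReg, Config.setTab, Function.update_apply] using h3
    · simpa [Config.tick, Config.setReg, Config.setTab, Function.update_apply] using h4
    · simpa [Config.tick, Config.setReg, Config.setTab, Function.update_apply] using h5
    · refine (new j).trans_lt ?_
      split_ifs with h
      · exact hlt
      · exact h6 j (by omega)
    · simp only [Config.tick, Config.setReg, Config.setTab, Expr.steps]
      omega
    · rintro ⟨⟩
    · exact (new i).trans (if_pos rfl)
    · exact (new j).trans (if_neg hj.ne)
  | withoutReplacement =>
    simp only [choiceCount] at hr
    set a := ((((s.setReg .i i).tick 1).setReg .r r).tick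
      ((choices .withoutReplacement).steps + 1)) with ha
    have final : Ensures (storeChoice .withoutReplacement) a fun t =>
        t.reg .n = n ∧ t.reg .k = K ∧ (∀ x, x ≠ .swap → x ≠ .sample → t.tab x = s.tab x) ∧
        t.requests = [] ∧ t.time ≤ T + 60 * (i + 1) ∧
        (∀ j, samples t j = if j = i then entry s (i + r) else samples s j) ∧
        ∀ j, entry t j = if j = i + r then entry s i else entry s j := by
      simp only [storeChoice, ensures_seq, ensures_set, ensures_when, ensures_put, ha, choices,
        Config.tick, Config.setReg, Config.setTab, Expr.eval, Expr.steps, Function.update_apply,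
        reduceCtorEq, if_true, if_false, ne_eq, ite_eq_right_iff, one_ne_zero, imp_false, not_not,
        h1, h2, h5, true_and, samples, entry]
      -- The cases are whether positions `i + r` and `i` still hold their default entries.
      refine ⟨fun e1 => ⟨fun e2 => ?_, fun e2 => ?_⟩, fun e1 => ⟨fun e2 => ?_, fun e2 => ?_⟩⟩ <;>
      · refine ⟨fun x hx hx' => by simp [hx, hx'], by omega, fun j => ?_, fun j => ?_⟩
        · by_cases hj : j = i <;> simp [hj, e1]
        · by_cases hj : j = i + r <;> simp [hj, e2]
    refine final.mono ?_
    rintro t ⟨g1, g2, g3, g4, g5, g6, g7⟩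
    refine ⟨⟨g1, g2, ?_, ?_, g4, fun j hj => ?_, g5, fun _ => ?_⟩, ?_, fun j hj => ?_⟩
    · rw [g3 _ (by simp) (by simp)]
      exact h3
    · rw [g3 _ (by simp) (by simp)]
      exact h4
    · rw [g6]
      split_ifs with h
      · exact hlt
      · exact h6 j (by omega)
    · exact (h8 rfl).next hr (by rw [g6, if_pos rfl])
        (fun j hj => by rw [g6, if_neg hj.ne]) g7
    · rw [g6, if_pos rfl, chosen]
    · rw [g6, if_neg hj.ne]

theorem eval_choices {sampling : Sampling} {n K T i : ℕ} {s : Config Reg Tab}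
    (hs : Drawn sampling n K T i s) :
    (choices sampling).eval ((s.setReg .i i).tick 1) = choiceCount sampling n i := by
  cases sampling <;>
  simp [choices, choiceCount, Expr.eval, Config.setReg, Config.tick, hs.reg_n]

theorem choiceCount_pos {n i : ℕ} (sampling : Sampling) (h : i < n) :
    0 < choiceCount sampling n i := by
  cases sampling <;> simp only [choiceCount] <;> omega

theorem ensures_draw {sampling : Sampling} {n K T i : ℕ} {s : Config Reg Tab} (hi : i < n)
    (hs : Drawn sampling n K T i s) :
    Ensures (.seq (.rand .r (choices sampling)) (storeChoice sampling)) ((s.setReg .i i).tick 1)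
      (Drawn sampling n K T (i + 1)) := by
  rw [ensures_seq]
  refine ensures_rand fun r hr => ?_
  rw [eval_choices hs] at hr
  have := choiceCount_pos sampling hi
  exact (ensures_storeChoice hs (by omega)).mono fun t ht => ht.drawn

theorem Sized.drawn {n Q : ℕ} {s : Config Reg Tab} (hs : Sized n Q s) (sampling : Sampling) :
    Drawn sampling n (sampleSize n Q) (21 * Q + 48) 0 (s.tick 2) where
  reg_n := hs.reg_n
  reg_k := hs.reg_k
  mark := hs.tab .mark
  label := hs.tab .label
  requests := hs.requests
  lt j hj := by omega
  time := by
    have := hs.time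
    simp only [Config.tick]
    omega
  shuffled _ := by
    have h : ∀ j, entry (s.tick 2) j = j := fun j => by simp [entry, Config.tick, hs.tab]
    exact ⟨fun j _ hj => by rwa [h], fun j _ _ j' _ _ e => by rwa [h, h] at e,
      fun x hx => Or.inr ⟨x, Nat.zero_le x, hx, h x⟩⟩

theorem ensures_drawSample {n Q : ℕ} {s : Config Reg Tab} (sampling : Sampling) (hs : Sized n Q s) :
    Ensures (drawSample sampling) s
      (Drawn sampling n (sampleSize n Q) (21 * Q + 48) (sampleSize n Q)) := by
  have hk : (var Reg.k : Expr Reg Tab).eval s = sampleSize n Q := hs.reg_k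
  rw [drawSample_eq]
  refine ensures_loop (Drawn sampling n (sampleSize n Q) (21 * Q + 48)) (hs.drawn sampling) ?_ ?_
  · intro i hi t ht
    rw [hk] at hi
    exact ensures_draw (hi.trans_le (sampleSize_le n Q)) ht
  · rw [hk]
    exact fun t ht => ht

/-! ### The expected potential -/

/-- The potential of a partial clustering after `i` steps. -/
noncomputable def potential {n : ℕ} (G : SimpleGraph (Fin n)) (o : Fin n → ℕ) (c : ℝ≥0∞) (i : ℕ)
    (l : Fin n → ℕ) : ℝ≥0∞ :=
  costPotential G o l + c * edgePotential G i l

/-- Averaging over a uniformly random pivot from a set of vertices that includes all unlabelled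
ones does not increase the potential. -/
theorem sum_potential_le {n : ℕ} (G : SimpleGraph (Fin n)) (o : Fin n → ℕ) (c : ℝ≥0∞) {i m : ℕ}
    {l : Fin n → ℕ} (hl : ∀ w, l w ≤ i) (σ : Fin m → Fin n) (hσ : Function.Injective σ)
    (hcover : ∀ w, l w = 0 → ∃ r, σ r = w) :
    ∑ r, potential G o c (i + 1) (pivotStep G i l (σ r)) ≤ m * potential G o c i l := by
  have hA : unlabelled l ⊆ Finset.univ.map ⟨σ, hσ⟩ := by
    intro w hw
    obtain ⟨r, rfl⟩ := hcover w (mem_unlabelled.1 hw)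
    simp
  have hcard : (Finset.univ.map ⟨σ, hσ⟩).card = m := by simp
  have h1 := sum_costPotential_le G o hl hA
  have h2 := sum_edgePotential_le G i hA
  rw [hcard, Finset.sum_map] at h1 h2
  simp only [potential, Finset.sum_add_distrib, ← Finset.mul_sum, mul_add]
  rw [mul_left_comm]
  refine add_le_add ?_ (mul_le_mul_right ?_ c)
  · exact_mod_cast h1
  · exact_mod_cast h2

theorem chosen_inj {sampling : Sampling} {n K T i r r' : ℕ} {s : Config Reg Tab}
    (hs : Drawn sampling n K T i s) (hr : r < choiceCount sampling n i)
    (hr' : r' < choiceCount sampling n i)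
    (h : chosen sampling s i r = chosen sampling s i r') : r = r' := by
  cases sampling with
  | withReplacement => exact h
  | withoutReplacement =>
    simp only [choiceCount] at hr hr'
    have := (hs.shuffled rfl).inj _ (by omega) (by omega) _ (by omega) (by omega) h
    omega

/-- Together with `chosen_inj`, this makes the next vertex uniform on a set containing all unsampled
vertices, hence all unlabelled ones. -/
theorem exists_chosen {sampling : Sampling} {n K T i x : ℕ} {s : Config Reg Tab}
    (hs : Drawn sampling n K T i s) (hx : x < n) (hnew : ∀ j < i, samples s j ≠ x) :
    ∃ r < choiceCount sampling n i, chosen sampling s i r = x := by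
  cases sampling with
  | withReplacement => exact ⟨x, hx, rfl⟩
  | withoutReplacement =>
    rcases (hs.shuffled rfl).cover x hx with ⟨j, hj, h⟩ | ⟨j, h1, h2, h⟩
    · exact absurd h (hnew j hj)
    · refine ⟨j - i, ?_, ?_⟩
      · simp only [choiceCount]
        omega
      · rw [chosen, Nat.add_sub_cancel' h1, h]

/-- The supermartingale step: the clustering phase has not run yet, but its labels are already
determined by the sample drawn so far. -/
theorem expectedValue_draw_le {sampling : Sampling} {n K T i : ℕ} {s : Config Reg Tab}
    (G : SimpleGraph (Fin n)) (o : Fin n → ℕ) (c : ℝ≥0∞) (hi : i < n)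
    (hs : Drawn sampling n K T i s) :
    expectedValue ((Cmd.seq (.rand .r (choices sampling)) (storeChoice sampling)).run
        ((s.setReg .i i).tick 1))
      (fun t => potential G o c (i + 1) (pivotLabels G (samples t) (i + 1))) ≤
      potential G o c i (pivotLabels G (samples s) i) := by
  have hm := eval_choices hs
  set m := choiceCount sampling n i
  -- The value 0 is a dummy: only `r < m` occurs.
  let h : ℕ → ℝ≥0∞ := fun r => if hr : r < m then potential G o c (i + 1)
    (pivotStep G i (pivotLabels G (samples s) i) ⟨chosen sampling s i r, chosen_lt hs hr⟩) else 0
  refine expectedValue_rand_seq_le h (by rw [hm]; exact choiceCount_pos sampling hi) ?_ ?_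
  · intro r hr
    rw [hm] at hr
    refine (ensures_storeChoice hs hr).mono fun t ht => le_of_eq ?_
    simp only [h, dif_pos hr, pivotLabels, pivotLabels_congr G ht.old, ht.new]
    rw [dif_pos (chosen_lt hs hr)]
  · rw [hm, Finset.sum_range]
    simp only [h, Fin.is_lt, dif_pos]
    refine sum_potential_le G o c (pivotLabels_le G _ i)
      (fun r : Fin m => ⟨chosen sampling s i r, chosen_lt hs r.2⟩) ?_ ?_
    · intro r r' hrr
      exact Fin.ext (chosen_inj hs r.2 r'.2 (congrArg Fin.val hrr))
    · intro w hw
      obtain ⟨r, hr, e⟩ := exists_chosen hs w.2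
        fun j hj hjw => pivotLabels_ne_zero G hj hjw hw
      exact ⟨⟨r, hr⟩, Fin.ext e⟩

theorem expectedValue_drawSample_le {n Q : ℕ} {s : Config Reg Tab} (sampling : Sampling)
    (hs : Sized n Q s) (G : SimpleGraph (Fin n)) (o : Fin n → ℕ) (c : ℝ≥0∞) :
    expectedValue ((drawSample sampling).run s)
      (fun t => potential G o c (sampleSize n Q) (pivotLabels G (samples t) (sampleSize n Q))) ≤
      3 * (2 * (clusteringCost G o : ℝ≥0∞)) + c * (n : ℝ≥0∞) ^ 2 := by
  have hk : (var Reg.k : Expr Reg Tab).eval s = sampleSize n Q := hs.reg_k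
  have h0 : potential G o c 0 (fun _ => 0) =
      3 * (2 * (clusteringCost G o : ℝ≥0∞)) + c * (n : ℝ≥0∞) ^ 2 := by
    rw [potential, costPotential_zero, edgePotential_zero]
    push_cast
    rfl
  rw [drawSample_eq, Cmd.run]
  beta_reduce
  rw [hk, ← h0]
  exact expectedValue_iterateFor_le (I := Drawn sampling n (sampleSize n Q) (21 * Q + 48))
    (φ := fun i t => potential G o c i (pivotLabels G (samples t) i))
    (fun i hi t ht => ensures_draw (hi.trans_le (sampleSize_le n Q)) ht)
    (fun i hi t ht => expectedValue_draw_le G o c (hi.trans_le (sampleSize_le n Q)) ht)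
    (hs.drawn sampling)

/-! ### Requests -/

open Classical in
/-- The vertices not among the first `i` sampled ones. -/
noncomputable def unsampled (n : ℕ) (p : ℕ → ℕ) (i : ℕ) : Finset ℕ :=
  (Finset.range n).filter fun x => ∀ j < i, p j ≠ x

theorem mem_unsampled {n : ℕ} {p : ℕ → ℕ} {i x : ℕ} :
    x ∈ unsampled n p i ↔ x < n ∧ ∀ j < i, p j ≠ x := by
  simp [unsampled]

theorem unsampled_succ (n : ℕ) (p : ℕ → ℕ) (i : ℕ) :
    unsampled n p (i + 1) = (unsampled n p i).erase (p i) := by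
  ext x
  simp only [mem_unsampled, Finset.mem_erase, Nat.forall_lt_succ_right]
  rw [ne_comm]
  tauto

/-- The configurations in which the requests for the first `i` vertices of the sample have been
made. -/
structure Requested (n K T : ℕ) (p : ℕ → ℕ) (i : ℕ) (s : Config Reg Tab) : Prop where
  reg_n : s.reg .n = n
  reg_k : s.reg .k = K
  sample : samples s = p
  label : ∀ a b, s.tab .label a b = 0
  mark : ∀ x, s.tab .mark x 0 = 0 ↔ ∀ j < i, p j ≠ x
  card : n ≤ (unsampled n p i).card + i
  length : 2 * s.requests.length + (unsampled n p i).card ^ 2 + n ≤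
    n ^ 2 + (unsampled n p i).card
  mem : ∀ j < i, (∀ j' < j, p j' ≠ p j) → ∀ w < n, (∀ j' ≤ j, p j' ≠ w) → (p j, w) ∈ s.requests
  time : s.time ≤ T + i * (10 * n + 17)

/-- The body of the loop that requests the neighbourhoods. -/
def requestNeighbourhood : Cmd Reg Tab :=
  .seq (.set .v (get .sample (var .i) (const 0))) <|
  .when (eq (get .mark (var .v) (const 0)) (const 0)) <|
    .seq (.put .mark (var .v) (const 0) (const 1)) <|
    .loop .w (var .n) <|
      .when (eq (get .mark (var .w) (const 0)) (const 0)) <|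
        .ask (var .v) (var .w)

theorem card_filter_range_succ (U : Finset ℕ) (w : ℕ) :
    ((Finset.range (w + 1)).filter (· ∈ U)).card =
      ((Finset.range w).filter (· ∈ U)).card + if w ∈ U then 1 else 0 := by
  rw [Finset.range_add_one, Finset.filter_insert]
  split_ifs with h
  · rw [Finset.card_insert_of_notMem (by simp)]
  · rfl

/-- `U` is the set of unmarked vertices, which the loop does not alter; each of its members accounts
for exactly one new request. -/
theorem ensures_requestLoop {n v T L : ℕ} {U : Finset ℕ} {s : Config Reg Tab} (hn : s.reg .n = n)
    (hv : s.reg .v = v) (hU : ∀ x < n, s.tab .mark x 0 = 0 ↔ x ∈ U) (hUn : U ⊆ Finset.range n)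
    (hL : s.requests.length ≤ L) (hT : s.time ≤ T) :
    Ensures (.loop .w (var .n) (.when (eq (get .mark (var .w) (const 0)) (const 0)) <|
        .ask (var .v) (var .w))) s fun t =>
      t.reg .n = n ∧ t.reg .k = s.reg .k ∧ t.tab = s.tab ∧ t.requests.length ≤ L + U.card ∧
      (∀ x ∈ s.requests, x ∈ t.requests) ∧ (∀ w ∈ U, (v, w) ∈ t.requests) ∧
      t.time ≤ T + 10 * n + 2 := by
  refine ensures_loop (fun w t => t.reg .n = n ∧ t.reg .k = s.reg .k ∧ t.reg .v = v ∧
    t.tab = s.tab ∧ t.requests.length ≤ L + ((Finset.range w).filter (· ∈ U)).card ∧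
    (∀ x ∈ s.requests, x ∈ t.requests) ∧ (∀ w' < w, w' ∈ U → (v, w') ∈ t.requests) ∧
    t.time ≤ T + 10 * w + 2) ?_ ?_ ?_
  · refine ⟨hn, rfl, hv, rfl, by simpa [Config.tick] using hL, fun x hx => hx, by simp, ?_⟩
    simp only [Config.tick, Expr.steps]
    omega
  · rintro w hw t ⟨g1, g2, g3, g4, g5, g6, g7, g8⟩
    have hw' : w < n := by simpa [Expr.eval, hn] using hw
    have hmark := hU w hw'
    have hc := card_filter_range_succ U w
    simp only [ensures_when, ensures_ask, Config.tick, Config.setReg, Config.addRequest, Expr.eval,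
      Expr.steps, Function.update_apply, reduceCtorEq, if_true, if_false, ne_eq, ite_eq_right_iff,
      one_ne_zero, imp_false, not_not, g1, g2, g3, g4, hmark, true_and, List.length_cons,
      List.mem_cons, Prod.mk.injEq]
    refine ⟨fun h => ⟨?_, fun x hx => Or.inr (g6 x hx), fun w' h1 h2 => ?_, by omega⟩,
      fun h => ⟨?_, g6, fun w' h1 h2 => ?_, by omega⟩⟩
    · rw [if_pos h] at hc
      omega
    · rcases Nat.lt_succ_iff_lt_or_eq.1 h1 with h3 | h3
      · exact Or.inr (g7 w' h3 h2)
      · exact Or.inl h3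
    · omega
    · rcases Nat.lt_succ_iff_lt_or_eq.1 h1 with h3 | rfl
      · exact g7 w' h3 h2
      · exact absurd h2 h
  · rintro t ⟨g1, g2, g3, g4, g5, g6, g7, g8⟩
    simp only [Expr.eval, hn] at g5 g7 g8
    refine ⟨g1, g2, g4, g5.trans ?_, g6, fun w hw => g7 w (Finset.mem_range.1 (hUn hw)) hw, g8⟩
    gcongr
    intro x
    simp

theorem ensures_requestNeighbourhood {n K T i : ℕ} {p : ℕ → ℕ} {s : Config Reg Tab} (hp : p i < n)
    (hs : Requested n K T p i s) :
    Ensures requestNeighbourhood ((s.setReg .i i).tick 1) (Requested n K T p (i + 1)) := by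
  obtain ⟨h1, h2, h3, h4, h5, h6, h7, h8, h9⟩ := hs
  have hsucc := unsampled_succ n p i
  have hsample : s.tab .sample i 0 = p i := congrFun h3 i
  have hadd : (i + 1) * (10 * n + 17) = i * (10 * n + 17) + (10 * n + 17) := Nat.succ_mul _ _
  rw [requestNeighbourhood, ensures_seq, ensures_set, ensures_when]
  simp only [Config.tick, Config.setReg, Expr.eval, Expr.steps, Function.update_apply, reduceCtorEq,
    if_true, if_false, hsample, ne_eq, ite_eq_right_iff, one_ne_zero, imp_false, not_not, h5]
  constructor
  · intro hnew
    have hcard : (unsampled n p (i + 1)).card + 1 = (unsampled n p i).card := by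
      rw [hsucc]
      exact Finset.card_erase_add_one (mem_unsampled.2 ⟨hp, hnew⟩)
    rw [ensures_seq, ensures_put]
    have hmark : ∀ x, (if x = p i then 1 else s.tab .mark x 0) = 0 ↔ ∀ j < i + 1, p j ≠ x := by
      intro x
      rw [Nat.forall_lt_succ_right, ← h5]
      by_cases hx : x = p i
      · simp [hx]
      · simp [hx, Ne.symm hx]
    -- The vertex `p i` is marked before the loop, so the unmarked set is the one for `i + 1` and
    -- the pair of `p i` with itself is not requested.
    refine (ensures_requestLoop (n := n) (v := p i) (T := T + i * (10 * n + 17) + 15)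
      (L := s.requests.length) (U := unsampled n p (i + 1)) ?_ ?_ ?_ ?_ ?_ ?_).mono ?_
    · simpa [Config.tick, Config.setTab] using h1
    · simp [Config.tick, Config.setTab]
    · intro x hx
      have := hmark x
      rw [mem_unsampled, ← this]
      by_cases hxi : x = p i <;>
      simp [Config.tick, Config.setTab, Expr.eval, hx, hxi]
    · exact Finset.filter_subset _ _
    · simp [Config.tick, Config.setTab]
    · simp only [Config.tick, Config.setTab, Expr.steps]
      omega
    · rintro t ⟨g1, g2, g3, g4, g5, g6, g7⟩
      refine ⟨g1, ?_, ?_, ?_, ?_, ?_, ?_, ?_, ?_⟩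
      · rw [g2]
        simpa [Config.tick, Config.setTab] using h2
      · rw [← h3]
        funext j
        simp [samples, g3, Config.tick, Config.setTab]
      · simpa [g3, Config.tick, Config.setTab] using h4
      · intro x
        rw [← hmark x, g3]
        by_cases hxi : x = p i <;>
        simp [Config.tick, Config.setTab, Expr.eval, hxi]
      · omega
      · rw [← hcard] at h7
        -- With u unsampled vertices left, at most u requests are new, and (u+1)u - u(u-1) = 2u: the
        -- bound 2·length ≤ n(n-1) - u(u-1) persists.
        nlinarith
      · intro j hj hj1 w hw hj2
        rcases Nat.lt_succ_iff_lt_or_eq.1 hj with h | rfl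
        · exact g5 _ (h8 j h hj1 w hw hj2)
        · exact g6 w (mem_unsampled.2 ⟨hw, fun j' hj' => hj2 j' (by omega)⟩)
      · omega
  -- A repeated vertex requests nothing and leaves the unsampled set unchanged.
  · intro hold
    have hold' : ∃ j < i, p j = p i := by
      by_contra hcon
      push Not at hcon
      exact hold hcon
    obtain ⟨j0, hj0, hj0'⟩ := hold'
    have hU : unsampled n p (i + 1) = unsampled n p i := by
      rw [hsucc, Finset.erase_eq_of_notMem]
      exact fun h => (mem_unsampled.1 h).2 j0 hj0 hj0'
    refine ⟨?_, ?_, ?_, h4, ?_, ?_, ?_, ?_, ?_⟩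
    · simpa using h1
    · simpa using h2
    · exact h3
    · intro x
      rw [Nat.forall_lt_succ_right, ← h5]
      refine ⟨fun h => ⟨h, fun e => ?_⟩, fun h => h.1⟩
      exact (h5 x).1 h j0 hj0 (hj0'.trans e)
    · rw [hU]
      omega
    · rw [hU]
      exact h7
    · intro j hj hj1 w hw hj2
      rcases Nat.lt_succ_iff_lt_or_eq.1 hj with h | rfl
      · exact h8 j h hj1 w hw hj2
      · exact absurd hj0' (hj1 j0 hj0)
    · simp only
      omega

theorem ensures_requestNeighbourhoods {sampling : Sampling} {n K T : ℕ} {s : Config Reg Tab}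
    (hs : Drawn sampling n K T K s) :
    Ensures requestNeighbourhoods s (Requested n K (T + 60 * K + 2) (samples s) K) := by
  have hk : (var Reg.k : Expr Reg Tab).eval s = K := hs.reg_k
  have hU : unsampled n (samples s) 0 = Finset.range n := by
    ext x
    simp [mem_unsampled]
  refine ensures_loop (Requested n K (T + 60 * K + 2) (samples s)) ?_ ?_ ?_
  · refine ⟨hs.reg_n, hs.reg_k, rfl, hs.label, ?_, ?_, ?_, ?_, ?_⟩
    · simp [Config.tick, hs.mark]
    · simp [hU]
    · simp [hU, Config.tick, hs.requests]
    · intro j hj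
      omega
    · have := hs.time
      simp only [Config.tick, Expr.steps]
      omega
  · intro i hi t ht
    rw [hk] at hi
    exact ensures_requestNeighbourhood (hs.lt i hi) ht
  · rw [hk]
    exact fun t ht => ht

/-- At least n - k vertices stay unsampled, so 2·length ≤ n(n-1) - (n-k)(n-k-1) = (2n-1-k)k, which
is at most 2Q by the choice of k. Repetitions in the sample only lower the count. -/
theorem Requested.length_le {n Q T : ℕ} {p : ℕ → ℕ} {s : Config Reg Tab}
    (hs : Requested n (sampleSize n Q) T p (sampleSize n Q) s) : s.requests.length ≤ Q := by
  have h1 := hs.card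
  have h2 := hs.length
  have h3 := sampleSize_spec n Q
  have h4 := sampleSize_le n Q
  generalize (unsampled n p (sampleSize n Q)).card = u at h1 h2
  generalize sampleSize n Q = K at h1 h3 h4
  obtain ⟨m, rfl⟩ : ∃ m, n = K + m := ⟨n - K, by omega⟩
  -- Positivity of `K` keeps the truncated subtraction in `K + 2 * m - 1` exact.
  rcases Nat.eq_zero_or_pos K with rfl | hK
  · have : m ≤ u := by omega
    have : m = u ∨ m + 1 ≤ u := by omega
    rcases this with rfl | h
    · nlinarith
    · nlinarith
  · have e : 2 * (K + m) - 1 - K = K + 2 * m - 1 := by omega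
    rw [e] at h3
    have h5 : m ≤ u := by omega
    have h6 : (K + 2 * m - 1) * K + K = (K + 2 * m) * K := by
      obtain ⟨x, hx⟩ : ∃ x, K + 2 * m = x + 1 := ⟨K + 2 * m - 1, by omega⟩
      rw [hx, Nat.add_sub_cancel]
      ring
    have h7 : m ^ 2 + u ≤ u ^ 2 + m := by
      obtain ⟨y, rfl⟩ : ∃ y, u = m + y := ⟨u - m, by omega⟩
      nlinarith [Nat.le_self_pow two_ne_zero y, Nat.zero_le (m * y)]
    nlinarith

/-! ### The clustering phase -/

/-- The configurations in which the first `i` vertices of the sample have been considered. -/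
structure Clustered {n : ℕ} (G : SimpleGraph (Fin n)) (K T : ℕ) (p : ℕ → ℕ) (a : ℕ → ℕ → ℕ) (i : ℕ)
    (s : Config Reg Tab) : Prop where
  reg_n : s.reg .n = n
  reg_k : s.reg .k = K
  sample : samples s = p
  answers : s.answers = a
  label : ∀ w : Fin n, s.tab .label w 0 = pivotLabels G p i w
  time : s.time ≤ T + i * (21 * n + 13)

/-- The loop that forms a cluster. -/
def formCluster : Cmd Reg Tab :=
  .loop .w (var .n) <|
    .when (and (eq (get .label (var .w) (const 0)) (const 0))
      (or (eq (var .w) (var .v)) (answer (var .v) (var .w)))) <|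
      .put .label (var .w) (const 0) (add (var .i) (const 1))

/-- The sequential loop performs the simultaneous update of `pivotStep`: the test for `w` reads no
label but that of `w`, and the label of `v` was tested before the loop. Answers matter only for
unlabelled `w ≠ v`. -/
theorem ensures_formCluster {n : ℕ} (G : SimpleGraph (Fin n)) {i T : ℕ} {v : Fin n} {l : Fin n → ℕ}
    {s : Config Reg Tab} (hn : s.reg .n = n) (hi : s.reg .i = i) (hv : s.reg .v = v)
    (hl : ∀ w : Fin n, s.tab .label w 0 = l w) (hlv : l v = 0)
    (ha : ∀ w : Fin n, l w = 0 → w ≠ v → (s.answers v w ≠ 0 ↔ G.Adj v w)) (hT : s.time ≤ T) :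
    Ensures formCluster s fun t => t.reg .n = n ∧ t.reg .k = s.reg .k ∧
      samples t = samples s ∧ t.answers = s.answers ∧
      (∀ w : Fin n, t.tab .label w 0 = pivotStep G i l v w) ∧ t.time ≤ T + 21 * n + 2 := by
  refine ensures_loop (fun m t => t.reg .n = n ∧ t.reg .k = s.reg .k ∧ t.reg .i = i ∧
    t.reg .v = v ∧ samples t = samples s ∧ t.answers = s.answers ∧
    (∀ w : Fin n, t.tab .label w 0 = if (w : ℕ) < m then pivotStep G i l v w else l w) ∧
    t.time ≤ T + 21 * m + 2) ?_ ?_ ?_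
  · refine ⟨hn, rfl, hi, hv, rfl, rfl, ?_, ?_⟩
    · simpa [Config.tick] using hl
    · simp only [Config.tick, Expr.steps]
      omega
  · rintro m hm t ⟨g1, g2, g3, g4, g5, g6, g7, g8⟩
    have hm' : m < n := by simpa [Expr.eval, hn] using hm
    have hlm : t.tab .label m 0 = l ⟨m, hm'⟩ := by simpa using g7 ⟨m, hm'⟩
    have hcond : (l ⟨m, hm'⟩ = 0 ∧ (m = v ∨ s.answers v m ≠ 0)) ↔
        (l v = 0 ∧ l ⟨m, hm'⟩ = 0 ∧ (⟨m, hm'⟩ = v ∨ G.Adj v ⟨m, hm'⟩)) := by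
      have e : m = v ↔ (⟨m, hm'⟩ : Fin n) = v := by rw [Fin.ext_iff]
      have := ha ⟨m, hm'⟩
      simp only at this
      rw [e]
      tauto
    have hother : ∀ w : Fin n, (w : ℕ) ≠ m → ((w : ℕ) < m + 1 ↔ (w : ℕ) < m) := by
      intro w hw
      omega
    simp only [ensures_when, ensures_put, Config.tick, Config.setReg, Config.setTab, Expr.eval,
      Expr.steps, Function.update_apply, reduceCtorEq, if_true, if_false, ne_eq, ite_eq_right_iff,
      one_ne_zero, imp_false, not_not, g1, g2, g3, g4, g6, hlm, true_and] at hcond ⊢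
    constructor
    · intro h
      refine ⟨g5, fun w => ?_, by omega⟩
      by_cases hw : (w : ℕ) = m
      · obtain rfl : w = ⟨m, hm'⟩ := Fin.ext hw
        have := hcond.1 h
        simp [pivotStep, this]
      · simp only [hw, if_false, hother w hw]
        exact g7 w
    · intro h
      refine ⟨g5, fun w => ?_, by omega⟩
      by_cases hw : (w : ℕ) = m
      · obtain rfl : w = ⟨m, hm'⟩ := Fin.ext hw
        have h' : ¬ (l v = 0 ∧ l ⟨m, hm'⟩ = 0 ∧ (⟨m, hm'⟩ = v ∨ G.Adj v ⟨m, hm'⟩)) :=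
          fun hc => h (hcond.2 hc)
        rw [hlm, if_pos (Nat.lt_succ_self m), pivotStep, if_neg h']
      · simp only [hother w hw]
        exact g7 w
  · rintro t ⟨g1, g2, g3, g4, g5, g6, g7, g8⟩
    simp only [Expr.eval, hn, Fin.is_lt, if_true] at g7 g8
    exact ⟨g1, g2, g5, g6, g7, g8⟩

theorem ensures_clusterPhase {n : ℕ} (G : SimpleGraph (Fin n)) {K T : ℕ} {s : Config Reg Tab}
    (hn : s.reg .n = n) (hk : s.reg .k = K) (hlt : ∀ i < K, samples s i < n)
    (hl : ∀ w, s.tab .label w 0 = 0) (hT : s.time ≤ T)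
    (ha : ∀ i < K, (∀ j < i, samples s j ≠ samples s i) → ∀ v w : Fin n, samples s i = v →
      (∀ j ≤ i, samples s j ≠ w) → (s.answers v w ≠ 0 ↔ G.Adj v w)) :
    Ensures clusterPhase s (Clustered G K (T + 2) (samples s) s.answers K) := by
  have hk' : (var Reg.k : Expr Reg Tab).eval s = K := hk
  refine ensures_loop (Clustered G K (T + 2) (samples s) s.answers) ?_ ?_ ?_
  · refine ⟨hn, hk, rfl, rfl, fun w => hl w, ?_⟩
    simp only [Config.tick, Expr.steps]
    omega
  · rintro i hi t ⟨h1, h2, h3, h4, h5, h6⟩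
    rw [hk'] at hi
    have hsample : t.tab .sample i 0 = samples s i := congrFun h3 i
    have hadd : (i + 1) * (21 * n + 13) = i * (21 * n + 13) + (21 * n + 13) := Nat.succ_mul _ _
    obtain ⟨v, hv⟩ : ∃ v : Fin n, samples s i = v := ⟨⟨_, hlt i hi⟩, rfl⟩
    have hnext : pivotLabels G (samples s) (i + 1) = pivotStep G i (pivotLabels G (samples s) i) v := by
      simp [pivotLabels, hv]
    rw [ensures_seq, ensures_set, ensures_when]
    simp only [Config.tick, Config.setReg, Expr.eval, Expr.steps, Function.update_apply,
      reduceCtorEq, if_true, if_false, hsample, ne_eq, ite_eq_right_iff, one_ne_zero, imp_false,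
      not_not, hv, h5]
    constructor
    · intro h0
      change Ensures formCluster _ _
      refine (ensures_formCluster G (i := i) (T := T + 2 + i * (21 * n + 13) + 11) (v := v)
        (l := pivotLabels G (samples s) i) ?_ ?_ ?_ (by exact h5) h0 ?_ ?_).mono ?_
      · simpa using h1
      · simp
      · simp
      · intro w hw hwv
        simp only [h4]
        -- An unlabelled pivot occurs here for the first time, and an unlabelled `w ≠ v` has not
        -- been sampled yet; so the answer for `(v, w)`, in this order, is available.
        refine ha i hi (fun j hj e => pivotLabels_ne_zero G hj (e.trans hv) h0) v w hv fun j hj e => ?_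
        rcases Nat.lt_or_eq_of_le hj with hj | rfl
        · exact pivotLabels_ne_zero G hj e hw
        · exact hwv (Fin.ext (e.symm.trans hv))
      · simp only
        omega
      · rintro u ⟨g1, g2, g3, g4, g5, g6⟩
        refine ⟨g1, ?_, g3.trans h3, g4.trans h4, fun w => ?_, by omega⟩
        · rw [g2]
          simpa using h2
        · rw [g5, hnext]
    · intro h0
      refine ⟨?_, ?_, h3, h4, fun w => ?_, ?_⟩
      · simpa using h1
      · simpa using h2
      · rw [hnext, pivotStep_of_ne_zero G i _ h0]
        exact h5 w
      · simp only
        omega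
  · rw [hk']
    exact fun t ht => ht

theorem ensures_clusterPhase_requests (s : Config Reg Tab) :
    Ensures clusterPhase s fun t => t.requests = s.requests := by
  refine ensures_loop (fun _ t => t.requests = s.requests) rfl (fun i _ t ht => ?_) fun t ht => ht
  rw [ensures_seq, ensures_set, ensures_when]
  refine ⟨fun _ => ?_, fun _ => ht⟩
  refine ensures_loop (fun _ t => t.requests = s.requests) ht (fun w _ u hu => ?_) fun t ht => ht
  rw [ensures_when, ensures_put]
  exact ⟨fun _ => hu, fun _ => hu⟩

/-! ### The whole algorithm -/

theorem ensures_clusterPhase_answerRequests {sampling : Sampling} {n Q T T' : ℕ}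
    (G : SimpleGraph (Fin n)) {s u : Config Reg Tab}
    (hs : Drawn sampling n (sampleSize n Q) T (sampleSize n Q) s)
    (hu : Requested n (sampleSize n Q) T' (samples s) (sampleSize n Q) u) :
    Ensures clusterPhase (u.answerRequests G) fun t =>
      (∀ w : Fin n, t.tab .label w 0 = pivotLabels G (samples s) (sampleSize n Q) w) ∧
      t.time ≤ T' + sampleSize n Q * (10 * n + 17) + Q + 2 + sampleSize n Q * (21 * n + 13) := by
  have hsamples : samples (u.answerRequests G) = samples s := hu.sample
  have htime : (u.answerRequests G).time ≤ T' + sampleSize n Q * (10 * n + 17) + Q :=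
    Nat.add_le_add hu.time hu.length_le
  refine (ensures_clusterPhase G (s := u.answerRequests G)
    (T := T' + sampleSize n Q * (10 * n + 17) + Q) hu.reg_n hu.reg_k ?_ (fun w => hu.label w 0) htime ?_).mono fun t ht => ⟨fun w => ?_, ht.time⟩
  · rw [hsamples]
    exact hs.lt
  · intro i hi hfirst v w hv hw
    rw [hsamples] at hfirst hv hw
    have hmem := hu.mem i hi hfirst w w.2 hw
    rw [hv] at hmem
    simp [Config.answerRequests, hmem]
  · rw [ht.label, hsamples]

theorem two_mul_cost_le_potential {n K : ℕ} (G : SimpleGraph (Fin n)) (o : Fin n → ℕ) {c : ℝ≥0∞}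
    {l : Fin n → ℕ} {t : Config Reg Tab} (ht : ∀ w : Fin n, t.tab .label w 0 = l w)
    (hc : (innerEdges G (unlabelled l) : ℝ≥0∞) ≤ c * edgePotential G K l) :
    2 * (clusteringCost G (output n t) : ℝ≥0∞) ≤ potential G o c K l := by
  have h : output n t = fun v => if l v = 0 then 2 * (v : ℕ) else 2 * l v + 1 := by
    funext v
    simp only [output, ht]
  have h2 : 2 * clusteringCost G (output n t) = closedCost G l + innerEdges G (unlabelled l) := by
    rw [h, two_mul_clusteringCost_of_labels]
  have h3 : (2 * (clusteringCost G (output n t) : ℝ≥0∞)) =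
      (closedCost G l : ℝ≥0∞) + (innerEdges G (unlabelled l) : ℝ≥0∞) := by exact_mod_cast h2
  rw [h3, potential]
  refine add_le_add ?_ hc
  exact_mod_cast Nat.le_add_right _ _

/-- The term `n * card` of `edgePotential` is worth one more copy of `innerEdges`, which improves
the factor from `K` to `K + 1`. -/
theorem innerEdges_le_inv_mul_edgePotential {n : ℕ} (G : SimpleGraph (Fin n)) (K : ℕ)
    (l : Fin n → ℕ) : (innerEdges G (unlabelled l) : ℝ≥0∞) ≤
      ((K + 1 : ℕ) : ℝ≥0∞)⁻¹ * edgePotential G K l := by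
  rw [← ENNReal.div_eq_inv_mul, ENNReal.le_div_iff_mul_le (by simp) (by simp)]
  have := innerEdges_le G (unlabelled l)
  have h : innerEdges G (unlabelled l) * (K + 1) ≤ edgePotential G K l := by
    rw [edgePotential]
    nlinarith
  exact_mod_cast h

theorem inv_mul_sq_le {n Q K : ℕ} (h : Q ≤ (K + 1) * n) (hQ : 0 < Q) :
    ((K + 1 : ℕ) : ℝ≥0∞)⁻¹ * (n : ℝ≥0∞) ^ 2 ≤ (n : ℝ≥0∞) ^ 3 / Q := by
  rw [← ENNReal.div_eq_inv_mul]
  refine ENNReal.div_le_of_le_mul' ?_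
  rw [← mul_div_assoc, ENNReal.le_div_iff_mul_le (by simp [hQ.ne']) (by simp)]
  have : n ^ 2 * Q ≤ (K + 1) * n ^ 3 := by
    calc n ^ 2 * Q ≤ n ^ 2 * ((K + 1) * n) := Nat.mul_le_mul_left _ h
      _ = _ := by ring
  exact_mod_cast this

/-- The weight of the edge potential. If all vertices are sampled, then it may be zero. -/
theorem exists_weight {sampling : Sampling} {n Q : ℕ} (G : SimpleGraph (Fin n)) (hQ : 0 < Q)
    (h : sampling = .withoutReplacement ∨ Q ≤ n ^ 2) :
    ∃ c : ℝ≥0∞, c * (n : ℝ≥0∞) ^ 2 ≤ (n : ℝ≥0∞) ^ 3 / Q ∧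
      ∀ T s, Drawn sampling n (sampleSize n Q) T (sampleSize n Q) s →
        (innerEdges G (unlabelled (pivotLabels G (samples s) (sampleSize n Q))) : ℝ≥0∞) ≤
          c * edgePotential G (sampleSize n Q) (pivotLabels G (samples s) (sampleSize n Q)) := by
  by_cases hQn : Q ≤ (sampleSize n Q + 1) * n
  · exact ⟨_, inv_mul_sq_le hQn hQ, fun T s _ => innerEdges_le_inv_mul_edgePotential G _ _⟩
  have hK : sampleSize n Q = n := by
    by_contra hne
    exact hQn (le_succ_sampleSize_mul (lt_of_le_of_ne (sampleSize_le n Q) hne))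
  rcases h with rfl | h
  -- A sample of n distinct vertices leaves no vertex unlabelled.
  · refine ⟨0, by simp, fun T s hs => ?_⟩
    have hempty : unlabelled (pivotLabels G (samples s) (sampleSize n Q)) = ∅ := by
      refine Finset.eq_empty_of_forall_notMem fun w hw => ?_
      rcases (hs.shuffled rfl).cover w w.2 with ⟨j, hj, e⟩ | ⟨j, h1, h2, -⟩
      · exact pivotLabels_ne_zero G hj e (mem_unlabelled.1 hw)
      · omega
    simp [hempty, innerEdges]
  -- With replacement, vertices may be missed even for k = n, but then Q ≤ n² ≤ (k+1)n and the first
  -- weight already applies.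
  · refine absurd ?_ hQn
    rw [hK]
    nlinarith

theorem expectedValue_cost_le {sampling : Sampling} {n Q : ℕ} (G : SimpleGraph (Fin n))
    (hQ : 0 < Q) (h : sampling = .withoutReplacement ∨ Q ≤ n ^ 2) :
    expectedValue (run sampling G Q) (fun s => (clusteringCost G (output n s) : ℝ≥0∞)) ≤
      3 * (optCost G : ℝ≥0∞) + (n : ℝ≥0∞) ^ 3 / (2 * (Q : ℝ≥0∞)) := by
  obtain ⟨o, ho⟩ := exists_clusteringCost_eq_optCost G
  obtain ⟨c, hc, hedges⟩ := exists_weight G hQ h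
  have key : 2 * expectedValue (run sampling G Q)
      (fun s => (clusteringCost G (output n s) : ℝ≥0∞)) ≤
      3 * (2 * (clusteringCost G o : ℝ≥0∞)) + c * (n : ℝ≥0∞) ^ 2 := by
    rw [← expectedValue_const_mul]
    simp only [run, queryPhase, Cmd.run, PMF.bind_bind]
    rw [expectedValue_bind]
    refine expectedValue_le_of_support fun a ha => ?_
    have ha' := ensures_computeK n Q a ha
    refine le_trans (expectedValue_bind_le fun s hs t ht => ?_)
      (expectedValue_drawSample_le sampling ha' G o c)
    have hs' := ensures_drawSample sampling ha' s hs
    obtain ⟨u, hu, ht⟩ := (PMF.mem_support_bind_iff _ _ _).1 ht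
    exact two_mul_cost_le_potential G o
      (ensures_clusterPhase_answerRequests G hs' (ensures_requestNeighbourhoods hs' u hu) t ht).1
      (hedges _ s hs')
  have h2 : 2 * (3 * (optCost G : ℝ≥0∞) + (n : ℝ≥0∞) ^ 3 / (2 * (Q : ℝ≥0∞))) =
      3 * (2 * (optCost G : ℝ≥0∞)) + (n : ℝ≥0∞) ^ 3 / Q := by
    rw [mul_add, mul_left_comm, ← mul_div_assoc,
      ENNReal.mul_div_mul_left _ _ two_ne_zero ENNReal.ofNat_ne_top]
  rw [← ENNReal.mul_le_mul_iff_right two_ne_zero ENNReal.ofNat_ne_top, h2, ← ho]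
  exact key.trans (add_le_add le_rfl hc)

theorem length_and_time_le {sampling : Sampling} {n Q : ℕ} (G : SimpleGraph (Fin n)) (hQ : 0 < Q)
    {t : Config Reg Tab} (ht : t ∈ (run sampling G Q).support) :
    t.requests.length ≤ Q ∧ t.time ≤ 378 * Q := by
  simp only [run, queryPhase, Cmd.run, PMF.bind_bind, PMF.mem_support_bind_iff] at ht
  obtain ⟨a, ha, s, hs, u, hu, ht⟩ := ht
  have hs' := ensures_drawSample sampling (ensures_computeK n Q a ha) s hs
  have hu' := ensures_requestNeighbourhoods hs' u hu
  have ht' := (ensures_clusterPhase_answerRequests G hs' hu' t ht).2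
  have hreq : t.requests = u.requests := ensures_clusterPhase_requests (u.answerRequests G) t ht
  refine ⟨hreq ▸ hu'.length_le, ht'.trans ?_⟩
  have h1 := sampleSize_le_succ n Q
  have h2 := sampleSize_mul_le (n := n) (Q := Q)
  -- Writing k for the sample size, the phases add up to 22Q + 52 + 90k + 31kn. With k ≤ Q + 1 and
  -- kn ≤ 3Q + 1 this is at most 205Q + 173, hence at most 378Q as Q ≥ 1.
  nlinarith

theorem eq_pure_of_support_subset {α : Type} {p : PMF α} {a : α} (h : p.support ⊆ {a}) :
    p = PMF.pure a := by
  have h1 := (p.apply_eq_one_iff a).2 ((Set.Nonempty.subset_singleton_iff p.support_nonempty).1 h)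
  ext x
  by_cases hx : x = a
  · simp [hx, h1]
  · have : x ∉ p.support := fun hs => hx (h hs)
    rw [PMF.mem_support_iff, not_not] at this
    simp [this, PMF.pure_apply, hx]

/-- The clustering phase makes no requests, and the querying phase is not given `G`; so the
right-hand side does not mention the graph. -/
theorem map_requests_run (sampling : Sampling) {n : ℕ} (G : SimpleGraph (Fin n)) (Q : ℕ) :
    (run sampling G Q).map (fun s => s.requests) =
      ((queryPhase sampling).run (init n Q)).map fun s => s.requests := by
  rw [run, PMF.map_bind, ← PMF.bind_pure_comp]
  congr 1
  funext s
  have h := ensures_clusterPhase_requests (s.answerRequests G)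
  refine (eq_pure_of_support_subset fun x hx => ?_ : _ = PMF.pure s.requests)
  obtain ⟨t, ht, rfl⟩ := (PMF.mem_support_map_iff _ _ _).1 hx
  exact h t ht

end NAQECC

theorem theorem2 :
    ∃ c : ℕ, ∀ (sampling : NAQECC.Sampling) (n Q : ℕ) (G : SimpleGraph (Fin n)), 0 < Q →
      -- expected cost (a sample drawn with replacement need not contain all the vertices, so for
      -- it the budget is taken within the quadratic range)
      ((sampling = .withoutReplacement ∨ Q ≤ n ^ 2) →
        expectedValue (NAQECC.run sampling G Q)
            (fun s => (clusteringCost G (NAQECC.output n s) : ℝ≥0∞)) ≤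
          3 * (optCost G : ℝ≥0∞) + (n : ℝ≥0∞) ^ 3 / (2 * (Q : ℝ≥0∞))) ∧
      -- number of queries, and running time
      (∀ s ∈ (NAQECC.run sampling G Q).support, s.requests.length ≤ Q ∧ s.time ≤ c * Q) ∧
      -- the queries do not depend on the answers
      (∀ H : SimpleGraph (Fin n),
        (NAQECC.run sampling G Q).map (fun s => s.requests) =
          (NAQECC.run sampling H Q).map (fun s => s.requests)) := by
  refine ⟨378, fun sampling n Q G hQ => ⟨NAQECC.expectedValue_cost_le G hQ,
    fun s hs => NAQECC.length_and_time_le G hQ hs, fun H => ?_⟩⟩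
  rw [NAQECC.map_requests_run, NAQECC.map_requests_run]
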